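/- An addition chain of length $r$ for a positive integer $N$ is a sequence $1=a_0<a_1<\dots<a_r=N$ of integers in which every $a_i$ with $i\ge 1$ is a sum of two (not necessarily distinct) preceding terms; $\ell(N)$ denotes the smallest length of an addition chain for $N$, and $v(N)$ the number of ones in the binary expansion of $N$. Let $m\ge 1$ and $k\ge 3$ be integers, let $c_1=5\cdot 2^{m+2}+3$ and $c_2=3\cdot 2^{m+1}+1$, and let $n$ be the integer with binary expansion $$n=101\underbrace{0\cdots0}_{m}11\underbrace{0\cdots0}_{k}11\underbrace{0\cdots0}_{m}1 .$$ Then $n=c_1\cdot 2^{m+k+3}+c_2$ and $v(n)=7$, and the Scholz conjecture holds for $n$: $$\ell(2^n-1)\le \ell(n)+n-1 .$$ -/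

import Mathlib

/-- `a 0, a 1, …, a r` is an addition chain `1 = a 0 < a 1 < ⋯ < a r = n` of length `r` for `n`:
every term after the first is a sum of two (possibly equal) preceding terms.
The values `a i` with `i > r` play no role. -/
def IsAdditionChain (n r : ℕ) (a : ℕ → ℕ) : Prop :=
  a 0 = 1 ∧ a r = n ∧ (∀ k < r, a k < a (k + 1)) ∧
    ∀ k, 1 ≤ k → k ≤ r → ∃ i < k, ∃ j < k, a k = a i + a j

/-- `ℓ(n)`: the least `r` for which there is an addition chain of length `r` for `n`. -/
noncomputable def chainLength (n : ℕ) : ℕ :=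
  sInf {r : ℕ | ∃ a : ℕ → ℕ, IsAdditionChain n r a}

/-- Every positive integer has an addition chain, so the infimum defining `chainLength n` is
attained. -/
theorem exists_isAdditionChain (n : ℕ) (hn : 0 < n) :
    ∃ a : ℕ → ℕ, IsAdditionChain n (chainLength n) a := by
  have h : {r : ℕ | ∃ a : ℕ → ℕ, IsAdditionChain n r a}.Nonempty := by
    refine ⟨n - 1, fun i => i + 1, rfl, by simp only []; omega, fun k _ => by simp only []; omega,
      fun k hk _ => ⟨k - 1, by omega, 0, by omega, by simp only []; omega⟩⟩
  exact Nat.sInf_mem h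

/-- `v(n)`: the number of ones in the binary expansion of `n`. -/
def binaryWeight (n : ℕ) : ℕ := (Nat.digits 2 n).count 1

/-- The binary digits of `101 0…0 11 0…0 11 0…0 1` with blocks of `m`, `k` and `m` zeros,
written from the most significant to the least significant one. -/
def thurberDigits (m k : ℕ) : List ℕ :=
  [1, 0, 1] ++ List.replicate m 0 ++ [1, 1] ++ List.replicate k 0 ++ [1, 1] ++
    List.replicate m 0 ++ [1]

/-- The integer whose binary expansion is `thurberDigits m k`
(`Nat.ofDigits` expects the least significant digit first). -/
def thurberNumber (m k : ℕ) : ℕ := Nat.ofDigits 2 (thurberDigits m k).reverse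

/-! Call a step small if it does not raise the integer part of the binary logarithm; a chain of
length `r` for `n` has `r - Nat.log 2 n` small steps. Here `Nat.log 2 n = 2 * m + k + 7`, and an
explicit star chain (each step uses the preceding term) has four small steps. The proof splits on
whether three small steps suffice. If not, the star chain is a shortest chain and, being a Hansen
chain, gives the bound through `IsAdditionChain.chainLength_mersenne_le`. If so, a general theorem
applies: whenever `chainLength n ≤ Nat.log 2 n + 3`, some shortest chain is a Hansen chain
(`IsReducedChain.isHansen`).

For the general theorem, take a shortest chain with the largest sum of terms. Minimality makes every
inner term indispensable for some later one. If `c` is used only in `e = c + z`, where `c = u + w`,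
then `c` can be traded for `z + u`, because `e = (z + u) + w`; maximality forces `z ≤ w`. Suppose
Hansen's condition fails at `D`, with preceding term `C`; then `D` does not use `C`. Both terms need
later dependents, and adding so small a number late costs growth. With no small step after `D` this
contradicts the exchange property (`false_of_forall_large`). Hence a small step follows, and
counting leaves exactly one before the term two places ahead of `D`, one in the two steps to `D`,
and one after. The possible beginnings reduce to three configurations, excluded by
`false_of_one_small`. -/

/-! ### Addition chains and their sets of terms. -/

/-- `S` is the set of terms of an addition chain for `n`: it consists of positive integers up to `n`
and contains `1`, `n` and, for every other element, two elements that it is the sum of. -/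
structure IsChainSet (n : ℕ) (S : Finset ℕ) : Prop where
  one_mem : 1 ∈ S
  mem : n ∈ S
  pos : ∀ x ∈ S, 1 ≤ x
  le : ∀ x ∈ S, x ≤ n
  sum : ∀ x ∈ S, x ≠ 1 → ∃ u ∈ S, ∃ w ∈ S, x = u + w

namespace IsAdditionChain

variable {n r : ℕ} {a : ℕ → ℕ}

theorem lt_of_lt (h : IsAdditionChain n r a) {i j : ℕ} (hij : i < j) (hj : j ≤ r) :
    a i < a j := by
  induction j with
  | zero => omega
  | succ j ih =>
    have h1 := h.2.2.1 j (by omega)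
    rcases Nat.lt_succ_iff_lt_or_eq.1 hij with h2 | rfl
    · exact (ih h2 (by omega)).trans h1
    · exact h1

theorem le_of_le (h : IsAdditionChain n r a) {i j : ℕ} (hij : i ≤ j) (hj : j ≤ r) :
    a i ≤ a j := by
  rcases hij.eq_or_lt with rfl | h1
  · exact le_rfl
  · exact (h.lt_of_lt h1 hj).le

theorem lt_of_apply_lt (h : IsAdditionChain n r a) {i j : ℕ} (hi : i ≤ r) (hij : a i < a j) :
    i < j := by
  by_contra hc
  exact absurd (h.le_of_le (not_lt.1 hc) hi) (by omega)

theorem le_of_apply_le (h : IsAdditionChain n r a) {i j : ℕ} (hi : i ≤ r) (hij : a i ≤ a j) :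
    i ≤ j := by
  by_contra hc
  exact absurd (h.lt_of_lt (not_le.1 hc) hi) (by omega)

theorem eq_of_apply_eq (h : IsAdditionChain n r a) {i j : ℕ} (hi : i ≤ r) (hj : j ≤ r)
    (hij : a i = a j) : i = j :=
  le_antisymm (h.le_of_apply_le hi hij.le) (h.le_of_apply_le hj hij.ge)

theorem pos (h : IsAdditionChain n r a) {i : ℕ} (hi : i ≤ r) : 1 ≤ a i := by
  have := h.le_of_le (Nat.zero_le i) hi
  rw [h.1] at this
  exact this

theorem step_le (h : IsAdditionChain n r a) {i : ℕ} (hi : i + 1 ≤ r) : a (i + 1) ≤ 2 * a i := by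
  obtain ⟨u, hu, w, hw, e⟩ := h.2.2.2 (i + 1) (by omega) hi
  have h1 := h.le_of_le (show u ≤ i by omega) (by omega)
  have h2 := h.le_of_le (show w ≤ i by omega) (by omega)
  omega

theorem add_le (h : IsAdditionChain n r a) (i d : ℕ) (hi : i + d ≤ r) :
    a (i + d) ≤ 2 ^ d * a i := by
  induction d with
  | zero => simp
  | succ d ih =>
    have h1 := ih (by omega)
    have h2 := h.step_le (i := i + d) (by omega)
    rw [pow_succ]
    have : a (i + (d + 1)) = a (i + d + 1) := rfl
    nlinarith

theorem isChainSet (h : IsAdditionChain n r a) :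
    IsChainSet n ((Finset.range (r + 1)).image a) where
  one_mem := Finset.mem_image.2 ⟨0, by simp, h.1⟩
  mem := Finset.mem_image.2 ⟨r, by simp, h.2.1⟩
  pos x hx := by
    obtain ⟨i, hi, rfl⟩ := Finset.mem_image.1 hx
    exact h.pos (by simpa [Nat.lt_succ_iff] using hi)
  le x hx := by
    obtain ⟨i, hi, rfl⟩ := Finset.mem_image.1 hx
    rw [← h.2.1]
    exact h.le_of_le (by simpa [Nat.lt_succ_iff] using hi) le_rfl
  sum x hx hx1 := by
    obtain ⟨i, hi, rfl⟩ := Finset.mem_image.1 hx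
    have hi' : i ≤ r := by simpa [Nat.lt_succ_iff] using hi
    have hi0 : i ≠ 0 := fun h0 => hx1 (h0 ▸ h.1)
    obtain ⟨u, hu, w, hw, e⟩ := h.2.2.2 i (by omega) hi'
    exact ⟨a u, Finset.mem_image.2 ⟨u, Finset.mem_range.2 (by omega), rfl⟩, a w,
      Finset.mem_image.2 ⟨w, Finset.mem_range.2 (by omega), rfl⟩, e⟩

theorem card_image (h : IsAdditionChain n r a) :
    ((Finset.range (r + 1)).image a).card = r + 1 := by
  rw [Finset.card_image_of_injOn, Finset.card_range]
  intro i hi j hj hij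
  simp only [Finset.coe_range, Set.mem_Iio] at hi hj
  exact h.eq_of_apply_eq (by omega) (by omega) hij

theorem chainLength_le (h : IsAdditionChain n r a) : chainLength n ≤ r :=
  Nat.sInf_le ⟨a, h⟩

end IsAdditionChain

namespace IsChainSet

variable {n : ℕ} {S : Finset ℕ}

/-- The increasing enumeration of a chain set is an addition chain. -/
theorem exists_isAdditionChain (h : IsChainSet n S) :
    ∃ r a, S.card = r + 1 ∧ IsAdditionChain n r a ∧ S = (Finset.range (r + 1)).image a := by
  obtain ⟨r, hr⟩ : ∃ r, S.card = r + 1 :=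
    ⟨S.card - 1, by have := Finset.card_pos.2 ⟨1, h.one_mem⟩; omega⟩
  set f := S.orderEmbOfFin hr with hf
  let a : ℕ → ℕ := fun k => if hk : k < r + 1 then f ⟨k, hk⟩ else 0
  have ha : ∀ k (hk : k < r + 1), a k = f ⟨k, hk⟩ := fun k hk => dif_pos hk
  have hmem : ∀ k, k < r + 1 → a k ∈ S := fun k hk => by
    rw [ha k hk]; exact S.orderEmbOfFin_mem hr _
  have hsurj : ∀ x ∈ S, ∃ k, k < r + 1 ∧ a k = x := fun x hx => by
    have : x ∈ Set.range f := by rw [hf, Finset.range_orderEmbOfFin]; exact hx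
    obtain ⟨k, rfl⟩ := this
    exact ⟨k, k.2, ha k k.2⟩
  have hmono : ∀ i j, i < r + 1 → j < r + 1 → (a i < a j ↔ i < j) := fun i j hi hj => by
    rw [ha i hi, ha j hj, OrderEmbedding.lt_iff_lt]; exact Iff.rfl
  have hle : ∀ i j, i < r + 1 → j < r + 1 → i ≤ j → a i ≤ a j := fun i j hi hj hij => by
    by_contra hc
    exact absurd ((hmono j i hj hi).1 (not_le.1 hc)) (by omega)
  have h0 : a 0 = 1 := by
    obtain ⟨k, hk, e⟩ := hsurj 1 h.one_mem
    have h1 := hle 0 k (by omega) hk (by omega)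
    have h2 := h.pos _ (hmem 0 (by omega))
    omega
  refine ⟨r, a, hr, ⟨h0, ?_, fun k hk => (hmono _ _ (by omega) (by omega)).2 (by omega), ?_⟩, ?_⟩
  · obtain ⟨k, hk, e⟩ := hsurj n h.mem
    have h1 := hle k r hk (by omega) (by omega)
    have h2 := h.le _ (hmem r (by omega))
    omega
  · intro k hk hkr
    have h1 : a k ≠ 1 := by
      have := (hmono 0 k (by omega) (by omega)).2 (by omega)
      omega
    obtain ⟨u, hu, w, hw, e⟩ := h.sum _ (hmem k (by omega)) h1
    obtain ⟨i, hi, rfl⟩ := hsurj u hu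
    obtain ⟨j, hj, rfl⟩ := hsurj w hw
    have hi1 := h.pos _ hu
    have hj1 := h.pos _ hw
    exact ⟨i, (hmono i k hi (by omega)).1 (by omega), j, (hmono j k hj (by omega)).1 (by omega), e⟩
  · ext x
    constructor
    · intro hx
      obtain ⟨k, hk, e⟩ := hsurj x hx
      exact Finset.mem_image.2 ⟨k, Finset.mem_range.2 hk, e⟩
    · intro hx
      obtain ⟨k, hk, rfl⟩ := Finset.mem_image.1 hx
      exact hmem k (Finset.mem_range.1 hk)

theorem chainLength_lt_card (h : IsChainSet n S) : chainLength n < S.card := by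
  obtain ⟨r, a, hr, ha, -⟩ := h.exists_isAdditionChain
  have := ha.chainLength_le
  omega

end IsChainSet

/-! ### Hansen chains and chains for `2 ^ n - 1`. -/

/-- The condition of Hansen: every term arises, together with all terms since some earlier
term `a p`, by adding terms to `a p`. -/
def IsHansen (r : ℕ) (a : ℕ → ℕ) : Prop :=
  ∀ i, 1 ≤ i → i ≤ r → ∃ p < i, ∀ t, p < t → t ≤ i → ∃ k < t, a t = a p + a k

/-- Hansen's condition lets a single run of `a i - a p` doublings of `2 ^ a p - 1` serve all `t` in
`(p, i]`; each such `t` then costs only one further element. The bound counts elements, so it is one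
more than the chain length. -/
theorem IsAdditionChain.exists_isChainSet_mersenne {n r : ℕ} {a : ℕ → ℕ}
    (h : IsAdditionChain n r a) (hH : IsHansen r a) (i : ℕ) (hi : i ≤ r) :
    ∃ T : Finset ℕ, IsChainSet (2 ^ a i - 1) T ∧ T.card ≤ i + a i ∧
      ∀ t ≤ i, 2 ^ a t - 1 ∈ T := by
  induction i using Nat.strong_induction_on with
  | _ i ih =>
  rcases Nat.eq_zero_or_pos i with rfl | hi0
  · refine ⟨{1}, ⟨by simp, by simp [h.1], by simp, by simp [h.1], by simp⟩, by simp [h.1], ?_⟩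
    intro t ht
    obtain rfl : t = 0 := by omega
    simp [h.1]
  obtain ⟨p, hp, hpt⟩ := hH i hi0 hi
  obtain ⟨T, hT, hcard, hTm⟩ := ih p hp (by omega)
  have hpi : a p < a i := h.lt_of_lt hp hi
  have hmono : ∀ {x y : ℕ}, x ≤ y → 2 ^ x - 1 ≤ 2 ^ y - 1 := fun hxy =>
    Nat.sub_le_sub_right (Nat.pow_le_pow_right (by omega) hxy) 1
  have hpos : ∀ x : ℕ, 1 ≤ 2 ^ x := fun x => Nat.one_le_two_pow
  have hpos' : ∀ {x : ℕ}, 1 ≤ x → 1 ≤ 2 ^ x - 1 := fun {x} hx => by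
    have : 2 ^ 1 ≤ 2 ^ x := Nat.pow_le_pow_right (by omega) hx
    omega
  set A := (Finset.Icc 1 (a i - a p)).image fun s => 2 ^ s * (2 ^ a p - 1) with hA
  set B := (Finset.Ioc p i).image fun t => 2 ^ a t - 1 with hB
  have hAm : ∀ s, 1 ≤ s → s ≤ a i - a p → 2 ^ s * (2 ^ a p - 1) ∈ T ∪ A ∪ B := fun s h1 h2 => by
    simp only [Finset.mem_union]
    exact Or.inl (Or.inr (Finset.mem_image.2 ⟨s, Finset.mem_Icc.2 ⟨h1, h2⟩, rfl⟩))
  have hBm : ∀ t ≤ i, 2 ^ a t - 1 ∈ T ∪ A ∪ B := fun t ht => by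
    simp only [Finset.mem_union]
    by_cases htp : t ≤ p
    · exact Or.inl (Or.inl (hTm t htp))
    · exact Or.inr (Finset.mem_image.2 ⟨t, Finset.mem_Ioc.2 ⟨by omega, ht⟩, rfl⟩)
  have hTsub : ∀ x ∈ T, x ∈ T ∪ A ∪ B := fun x hx => by
    simp only [Finset.mem_union]; exact Or.inl (Or.inl hx)
  refine ⟨T ∪ A ∪ B, ⟨hTsub _ hT.one_mem, hBm i le_rfl, ?_, ?_, ?_⟩, ?_, hBm⟩
  · intro x hx
    simp only [Finset.mem_union] at hx
    rcases hx with (hx | hx) | hx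
    · exact hT.pos x hx
    · obtain ⟨s, -, rfl⟩ := Finset.mem_image.1 hx
      exact Nat.mul_pos (hpos s) (hpos' (h.pos (by omega)))
    · obtain ⟨t, ht, rfl⟩ := Finset.mem_image.1 hx
      exact hpos' (h.pos (by have := (Finset.mem_Ioc.1 ht).2; omega))
  · intro x hx
    simp only [Finset.mem_union] at hx
    rcases hx with (hx | hx) | hx
    · exact (hT.le x hx).trans (hmono hpi.le)
    · obtain ⟨s, hs, rfl⟩ := Finset.mem_image.1 hx
      have hs2 := (Finset.mem_Icc.1 hs).2
      rw [Nat.mul_sub, ← pow_add, mul_one]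
      have h1 : 2 ^ (s + a p) ≤ 2 ^ a i := Nat.pow_le_pow_right (by omega) (by omega)
      have := hpos s
      omega
    · obtain ⟨t, ht, rfl⟩ := Finset.mem_image.1 hx
      exact hmono (h.le_of_le (Finset.mem_Ioc.1 ht).2 hi)
  · intro x hx hx1
    simp only [Finset.mem_union] at hx
    rcases hx with (hx | hx) | hx
    · obtain ⟨u, hu, w, hw, e⟩ := hT.sum x hx hx1
      exact ⟨u, hTsub u hu, w, hTsub w hw, e⟩
    · obtain ⟨s, hs, rfl⟩ := Finset.mem_image.1 hx
      obtain ⟨hs1, hs2⟩ := Finset.mem_Icc.1 hs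
      have key : 2 ^ (s - 1) * (2 ^ a p - 1) ∈ T ∪ A ∪ B := by
        rcases hs1.eq_or_lt with rfl | hs1
        · simpa using hBm p hp.le
        · exact hAm _ (by omega) (by omega)
      refine ⟨_, key, _, key, ?_⟩
      obtain ⟨s', rfl⟩ : ∃ s', s = s' + 1 := ⟨s - 1, by omega⟩
      rw [Nat.add_sub_cancel, pow_succ]
      ring
    · obtain ⟨t, ht, rfl⟩ := Finset.mem_image.1 hx
      obtain ⟨ht1, ht2⟩ := Finset.mem_Ioc.1 ht
      obtain ⟨k, hk, e⟩ := hpt t ht1 ht2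
      have hti := h.le_of_le ht2 hi
      -- `2 ^ (a p + a k) - 1 = 2 ^ a k * (2 ^ a p - 1) + (2 ^ a k - 1)`.
      refine ⟨_, hAm (a k) (h.pos (by omega)) (by omega), _, hBm k (by omega), ?_⟩
      rw [Nat.mul_sub, ← pow_add, mul_one, e, add_comm (a k)]
      have h1 : 2 ^ a k ≤ 2 ^ (a p + a k) := Nat.pow_le_pow_right (by omega) (by omega)
      have := hpos (a k)
      omega
  · calc (T ∪ A ∪ B).card ≤ T.card + A.card + B.card :=
          (Finset.card_union_le _ _).trans (Nat.add_le_add_right (Finset.card_union_le _ _) _)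
      _ ≤ (p + a p) + (a i - a p) + (i - p) := by
          refine Nat.add_le_add (Nat.add_le_add hcard ?_) ?_
          · exact Finset.card_image_le.trans (by simp)
          · exact Finset.card_image_le.trans (by simp)
      _ = i + a i := by omega

/-- The theorem of Hansen on the Scholz inequality. -/
theorem IsAdditionChain.chainLength_mersenne_le {n r : ℕ} {a : ℕ → ℕ}
    (h : IsAdditionChain n r a) (hH : IsHansen r a) :
    chainLength (2 ^ n - 1) ≤ r + n - 1 := by
  obtain ⟨T, hT, hcard, -⟩ := h.exists_isChainSet_mersenne hH r le_rfl
  rw [h.2.1] at hT hcard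
  have := hT.chainLength_lt_card
  omega

/-! ### Shortest chains and the exchange of terms. -/

/-- Every way to write `a e` as a sum of two earlier terms uses the term `a c`. -/
def NeedsTerm (a : ℕ → ℕ) (c e : ℕ) : Prop :=
  1 ≤ e ∧ ∀ i < e, ∀ j < e, a e = a i + a j → i = c ∨ j = c

/-- A shortest addition chain that cannot be improved by trading a term `a c = a u + a w`, used
only in `a e = a c + a z`, for the larger number `a z + a u`. -/
structure IsReducedChain (n r : ℕ) (a : ℕ → ℕ) : Prop where
  chain : IsAdditionChain n r a
  dep : ∀ c, 0 < c → c < r → ∃ e ≤ r, NeedsTerm a c e ∧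
    ((∃ e' ≤ r, e < e' ∧ NeedsTerm a c e') ∨
      ((∀ e' ≤ r, NeedsTerm a c e' → e' = e) ∧
        ∀ z < e, a e = a c + a z → z = c ∨ ∀ u < c, ∀ w < c, a c = a u + a w → a z ≤ a w))

/-- Among the shortest chains for `n`, one with the largest sum of terms is reduced. -/
theorem exists_isReducedChain (n : ℕ) (hn : 0 < n) :
    ∃ a, IsReducedChain n (chainLength n) a := by
  classical
  obtain ⟨a₀, ha₀⟩ := exists_isAdditionChain n hn
  set F := (Finset.powerset (Finset.range (n + 1))).filter
    fun S => IsChainSet n S ∧ S.card = chainLength n + 1 with hF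
  have hFm : ∀ S, S ∈ F ↔ IsChainSet n S ∧ S.card = chainLength n + 1 := fun S => by
    simp only [hF, Finset.mem_filter, Finset.mem_powerset, and_iff_right_iff_imp]
    intro h x hx
    exact Finset.mem_range.2 (Nat.lt_succ_iff.2 (h.1.le x hx))
  obtain ⟨S, hS, hmax⟩ := F.exists_max_image (fun S => ∑ x ∈ S, x)
    ⟨_, (hFm _).2 ⟨ha₀.isChainSet, ha₀.card_image⟩⟩
  obtain ⟨hS, hcard⟩ := (hFm S).1 hS
  obtain ⟨r, a, hr, ha, hSa⟩ := hS.exists_isAdditionChain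
  obtain rfl : r = chainLength n := by omega
  set r := chainLength n with hrdef
  have hmem : ∀ k ≤ r, a k ∈ S := fun k hk => by
    rw [hSa]; exact Finset.mem_image.2 ⟨k, Finset.mem_range.2 (by omega), rfl⟩
  have hidx : ∀ x ∈ S, ∃ k ≤ r, a k = x := fun x hx => by
    rw [hSa] at hx
    obtain ⟨k, hk, e⟩ := Finset.mem_image.1 hx
    exact ⟨k, by have := Finset.mem_range.1 hk; omega, e⟩
  -- a sum avoiding `a c`, unless the step depends on `c`
  have havoid : ∀ c e, e ≤ r → 1 ≤ e → ¬ NeedsTerm a c e → c ≤ r →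
      ∃ u ∈ S.erase (a c), ∃ w ∈ S.erase (a c), a e = u + w := by
    intro c e he he1 hd hc
    simp only [NeedsTerm, he1, true_and] at hd
    push Not at hd
    obtain ⟨i, hi, j, hj, e1, h1, h2⟩ := hd
    refine ⟨a i, Finset.mem_erase.2 ⟨fun h => h1 ?_, hmem i (by omega)⟩, a j,
      Finset.mem_erase.2 ⟨fun h => h2 ?_, hmem j (by omega)⟩, e1⟩
    · exact ha.eq_of_apply_eq (by omega) hc h
    · exact ha.eq_of_apply_eq (by omega) hc h
  refine ⟨a, ha, fun c hc hcr => ?_⟩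
  have hc1 : a c ≠ 1 := by
    have := ha.lt_of_lt hc hcr.le
    rw [ha.1] at this
    omega
  have hcn : a c ≠ n := by
    have := ha.lt_of_lt hcr le_rfl
    rw [ha.2.1] at this
    omega
  -- A term that nothing needs could be erased, against minimality of the length.
  have hex : ∃ e ≤ r, NeedsTerm a c e := by
    by_contra hno
    push Not at hno
    have : IsChainSet n (S.erase (a c)) := by
      refine ⟨Finset.mem_erase.2 ⟨hc1.symm, hS.one_mem⟩, Finset.mem_erase.2 ⟨hcn.symm, hS.mem⟩,
        fun x hx => hS.pos x (Finset.mem_of_mem_erase hx),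
        fun x hx => hS.le x (Finset.mem_of_mem_erase hx), fun x hx hx1 => ?_⟩
      obtain ⟨e, he, rfl⟩ := hidx x (Finset.mem_of_mem_erase hx)
      have he1 : e ≠ 0 := fun h => hx1 (h ▸ ha.1)
      exact havoid c e he (by omega) (hno e he) hcr.le
    have h1 := this.chainLength_lt_card
    rw [Finset.card_erase_of_mem (hmem c hcr.le)] at h1
    omega
  obtain ⟨e, he, hde⟩ := hex
  by_cases htwo : ∃ e' ≤ r, e' ≠ e ∧ NeedsTerm a c e'
  · obtain ⟨e', he', hne, hde'⟩ := htwo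
    rcases Nat.lt_or_gt_of_ne hne with h1 | h1
    · exact ⟨e', he', hde', Or.inl ⟨e, he, h1, hde⟩⟩
    · exact ⟨e, he, hde, Or.inl ⟨e', he', h1, hde'⟩⟩
  · have huniq : ∀ e' ≤ r, NeedsTerm a c e' → e' = e := fun e' he' hd => by
      by_contra hne
      exact htwo ⟨e', he', hne, hd⟩
    refine ⟨e, he, hde, Or.inr ⟨huniq, fun z hz hez => ?_⟩⟩
    by_contra hcon
    push Not at hcon
    obtain ⟨hzc, u, hu, w, hw, ecu, hlt⟩ := hcon
    have hpu := ha.pos (show u ≤ r by omega)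
    have hpw := ha.pos (show w ≤ r by omega)
    have hpz := ha.pos (show z ≤ r by omega)
    have huS : a u ∈ S.erase (a c) := Finset.mem_erase.2 ⟨by omega, hmem u (by omega)⟩
    have hwS : a w ∈ S.erase (a c) := Finset.mem_erase.2 ⟨by omega, hmem w (by omega)⟩
    have hzS : a z ∈ S.erase (a c) := Finset.mem_erase.2
      ⟨fun h => hzc (ha.eq_of_apply_eq (by omega) (by omega) h), hmem z (by omega)⟩
    -- The exchange: `a e = (a z + a u) + a w`, and every other term has a sum avoiding `a c`.
    have hT : IsChainSet n (insert (a z + a u) (S.erase (a c))) := by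
      refine ⟨Finset.mem_insert_of_mem (Finset.mem_erase.2 ⟨hc1.symm, hS.one_mem⟩),
        Finset.mem_insert_of_mem (Finset.mem_erase.2 ⟨hcn.symm, hS.mem⟩), ?_, ?_, ?_⟩
      · intro x hx
        rcases Finset.mem_insert.1 hx with rfl | hx
        · omega
        · exact hS.pos x (Finset.mem_of_mem_erase hx)
      · intro x hx
        rcases Finset.mem_insert.1 hx with rfl | hx
        · have := hS.le _ (hmem e he)
          omega
        · exact hS.le x (Finset.mem_of_mem_erase hx)
      · intro x hx hx1
        rcases Finset.mem_insert.1 hx with rfl | hx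
        · exact ⟨_, Finset.mem_insert_of_mem hzS, _, Finset.mem_insert_of_mem huS, rfl⟩
        · obtain ⟨f, hf, rfl⟩ := hidx x (Finset.mem_of_mem_erase hx)
          by_cases hfe : f = e
          · subst hfe
            exact ⟨_, Finset.mem_insert_self _ _, _, Finset.mem_insert_of_mem hwS, by omega⟩
          · have hf1 : f ≠ 0 := fun h => hx1 (h ▸ ha.1)
            obtain ⟨u', hu', w', hw', e'⟩ :=
              havoid c f hf (by omega) (fun hd => hfe (huniq f hf hd)) hcr.le
            exact ⟨u', Finset.mem_insert_of_mem hu', w', Finset.mem_insert_of_mem hw', e'⟩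
    -- Were the new number already a term, erasing `a c` alone would give a shorter chain.
    have hnot : a z + a u ∉ S.erase (a c) := by
      intro hin
      rw [Finset.insert_eq_self.2 hin] at hT
      have h1 := hT.chainLength_lt_card
      rw [Finset.card_erase_of_mem (hmem c hcr.le)] at h1
      omega
    have h1 := hmax _ ((hFm _).2 ⟨hT, by
      rw [Finset.card_insert_of_notMem hnot, Finset.card_erase_of_mem (hmem c hcr.le)]; omega⟩)
    rw [Finset.sum_insert hnot] at h1
    have h2 := Finset.add_sum_erase S (fun x => x) (hmem c hcr.le)
    omega

/-! ### Growth estimates. -/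

namespace IsAdditionChain

variable {n r : ℕ} {a : ℕ → ℕ}

/-- Among `s` doublings and one addition of `v`, growth is largest when the addition comes first. -/
theorem one_add_le (h : IsAdditionChain n r a) {p s v : ℕ} (hr : p + s + 1 ≤ r)
    (h1 : a (p + s + 1) = v + a (p + s)) : a (p + s + 1) ≤ 2 ^ s * (a p + v) := by
  have h2 := h.add_le p s (by omega)
  have h3 : 1 * v ≤ 2 ^ s * v := Nat.mul_le_mul_right _ Nat.one_le_two_pow
  rw [mul_add]
  omega

theorem two_add_le (h : IsAdditionChain n r a) {p s d v₁ v₂ : ℕ} (hr : p + s + 1 + d + 1 ≤ r)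
    (h1 : a (p + s + 1) = v₁ + a (p + s))
    (h2 : a (p + s + 1 + d + 1) = v₂ + a (p + s + 1 + d)) :
    a (p + s + 1 + d + 1) ≤ 2 ^ (s + d) * (a p + v₁ + v₂) := by
  have h3 := h.one_add_le (by omega) h1
  have h4 := h.one_add_le hr h2
  have h5 : 2 ^ d * (a (p + s + 1) + v₂) ≤ 2 ^ d * (2 ^ s * (a p + v₁) + 2 ^ s * v₂) := by
    have : 1 * v₂ ≤ 2 ^ s * v₂ := Nat.mul_le_mul_right _ Nat.one_le_two_pow
    exact Nat.mul_le_mul_left _ (by omega)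
  refine h4.trans (h5.trans (le_of_eq ?_))
  rw [pow_add]
  ring

/-- Past a term below `2 * H`, if all steps at least keep up with doubling `H`, then a term with a
small summand has its predecessor as the other summand. -/
theorem eq_pred_of_add (h : IsAdditionChain n r a) {p s z v H : ℕ}
    (hlow : 2 ^ (s + 2) * H ≤ a (p + s + 2)) (hr : p + s + 2 ≤ r) (hp : a p < 2 * H)
    (hv : v ≤ 2 * H) (hz : z < p + s + 2) (he : a (p + s + 2) = v + a z) : z = p + s + 1 := by
  by_contra hne
  have h1 := h.le_of_le (show z ≤ p + s by omega) (by omega)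
  have h2 := h.add_le p s (by omega)
  have h3 : 2 ^ s * (a p + 1) ≤ 2 ^ s * (2 * H) := Nat.mul_le_mul_left _ hp
  have h4 : 1 ≤ 2 ^ s := Nat.one_le_two_pow
  have h5 : 1 * (2 * H) ≤ 2 ^ s * (2 * H) := Nat.mul_le_mul_right _ h4
  rw [pow_add] at hlow
  have h6 : 2 ^ s * 2 ^ 2 * H = 2 ^ s * (2 * H) + 2 ^ s * (2 * H) := by ring
  rw [mul_add] at h3
  omega

theorem needsTerm_add (h : IsAdditionChain n r a) {c e : ℕ} (he : e ≤ r)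
    (hd : NeedsTerm a c e) : c < e ∧ ∃ z < e, a e = a c + a z := by
  obtain ⟨u, hu, w, hw, e1⟩ := h.2.2.2 e hd.1 he
  rcases hd.2 u hu w hw e1 with rfl | rfl
  · exact ⟨hu, w, hw, e1⟩
  · exact ⟨hw, u, hu, by omega⟩

end IsAdditionChain

theorem mul_le_of_two_pow_mul_le {k l H Z : ℕ} (h : 2 ^ (k + l) * H ≤ 2 ^ k * Z) :
    2 ^ l * H ≤ Z := by
  rw [pow_add, mul_assoc] at h
  exact Nat.le_of_mul_le_mul_left h (by positivity)

/-! ### Steps not using the preceding term, followed by at most one small step. -/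

namespace IsReducedChain

variable {n r : ℕ} {a : ℕ → ℕ}

/-- In a reduced chain, a step not using the preceding term is followed by a small step. -/
theorem false_of_forall_large (h : IsReducedChain n r a) {c H : ℕ} (hc : 1 ≤ c) (hcr : c + 1 ≤ r)
    (hns : ∀ k ≤ c, a (c + 1) ≠ a c + a k)
    (hlow : ∀ s, c + 1 + s ≤ r → 2 ^ s * H ≤ a (c + 1 + s)) (hup : a (c + 1) < 2 * H) :
    False := by
  have ha := h.chain
  obtain ⟨u, hu, w, hw, hD⟩ := ha.2.2.2 (c + 1) (by omega) hcr
  have huc : u < c := by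
    by_contra hcon
    obtain rfl : u = c := by omega
    exact hns w (by omega) hD
  have hwc : w < c := by
    by_contra hcon
    obtain rfl : w = c := by omega
    exact hns u (by omega) (by omega)
  obtain ⟨u', hu', w', hw', hC⟩ := ha.2.2.2 c hc (by omega)
  have hCD : a c < a (c + 1) := ha.lt_of_lt (by omega) hcr
  have hwC : a w < a c := ha.lt_of_lt hwc (by omega)
  have hw'C : a w' < a c := ha.lt_of_lt hw' (by omega)
  -- late dependents add to their predecessor
  have hlate : ∀ q, q = c ∨ q = c + 1 → ∀ e ≤ r, NeedsTerm a q e →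
      c + 2 ≤ e ∧ (c + 3 ≤ e → a e = a q + a (e - 1)) := by
    intro q hq e he hd
    obtain ⟨hqe, z, hz, hez⟩ := ha.needsTerm_add he hd
    refine ⟨?_, fun he3 => ?_⟩
    · by_contra hcon
      obtain ⟨rfl, rfl⟩ : q = c ∧ e = q + 1 := by omega
      exact hns z (by omega) hez
    · obtain ⟨s, rfl⟩ : ∃ s, e = c + 1 + s + 2 := ⟨e - (c + 3), by omega⟩
      have hv : a q ≤ a (c + 1) := ha.le_of_le (by omega) hcr
      have := ha.eq_pred_of_add (H := H) (hlow (s + 2) he) he hup (by omega) hz hez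
      rw [hez, this]
      rfl
  -- Two late additions give at most `2 ^ (s + d) * (2 * D + D + D)` with `D = a (c + 1) < 2 * H`,
  -- short of the required `2 ^ (s + d + 3) * H`.
  have huniq : ∀ q q', (q = c ∨ q = c + 1) → (q' = c ∨ q' = c + 1) → ∀ e e', c + 3 ≤ e → e < e' →
      e' ≤ r → NeedsTerm a q e → NeedsTerm a q' e' → False := by
    intro q q' hq hq' e e' he hee he' hd hd'
    have h1 := (hlate q hq e (by omega) hd).2 he
    have h2 := (hlate q' hq' e' he' hd').2 (by omega)
    obtain ⟨s, rfl⟩ : ∃ s, e = c + 2 + s + 1 := ⟨e - (c + 3), by omega⟩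
    obtain ⟨d, rfl⟩ : ∃ d, e' = c + 2 + s + 1 + d + 1 := ⟨e' - (c + 2 + s + 1 + 1), by omega⟩
    have h3 := ha.two_add_le he' h1 h2
    have h4 := hlow (s + d + 3) (by omega)
    rw [show c + 1 + (s + d + 3) = c + 2 + s + 1 + d + 1 by omega] at h4
    have h5 := mul_le_of_two_pow_mul_le (h4.trans h3)
    have h6 := ha.step_le (i := c + 1) (by omega)
    have h7 : a q ≤ a (c + 1) := ha.le_of_le (by omega) hcr
    have h8 : a q' ≤ a (c + 1) := ha.le_of_le (by omega) hcr
    have h9 : a (c + 2) = a (c + 1 + 1) := rfl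
    omega
  obtain ⟨e, he, hde, hC'⟩ := h.dep c hc (by omega)
  have he2 := (hlate c (Or.inl rfl) e he hde).1
  obtain ⟨f, hf, hdf, hD'⟩ := h.dep (c + 1) (by omega) (by omega)
  have hf2 := (hlate (c + 1) (Or.inr rfl) f hf hdf).1
  -- a common dependent is `a c + a (c + 1)`
  have hboth : ∀ e ≤ r, NeedsTerm a c e → NeedsTerm a (c + 1) e → a e = a (c + 1) + a c := by
    intro e he hd hd'
    obtain ⟨-, z, hz, hez⟩ := ha.needsTerm_add he hd'
    have hlt := (hlate c (Or.inl rfl) e he hd).1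
    rcases hd.2 (c + 1) (by omega) z hz hez with h1 | rfl
    · omega
    · exact hez
  -- There are too few late dependents for both terms to have two. The one with a single dependent
  -- violates the exchange condition, its partner there exceeding its own summands.
  rcases hC' with ⟨e', he', hee', hde'⟩ | ⟨-, hX⟩
  · have hDe : ∀ g ≤ r, NeedsTerm a (c + 1) g → g = c + 2 := by
      intro g hg hdg
      have hg2 := (hlate (c + 1) (Or.inr rfl) g hg hdg).1
      by_contra hne
      rcases Nat.lt_trichotomy g e' with h1 | h1 | h1
      · exact huniq (c + 1) c (by simp) (by simp) g e' (by omega) h1 he' hdg hde'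
      · subst h1
        have h1 := hboth g hg hde' hdg
        have h2 := (hlate c (Or.inl rfl) g hg hde').2 (by omega)
        have h3 := ha.eq_of_apply_eq (i := g - 1) (j := c + 1) (by omega) (by omega) (by omega)
        omega
      · exact huniq c (c + 1) (by simp) (by simp) e' g (by omega) h1 hg hde' hdg
    have hf3 := hDe f hf hdf
    have he3 : e = c + 2 := by
      by_contra hne
      exact huniq c c (by simp) (by simp) e e' (by omega) hee' he' hde hde'
    rcases hD' with ⟨f', hf', hff', hdf'⟩ | ⟨-, hX⟩
    · have := hDe f' hf' hdf'
      omega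
    · obtain rfl : e = f := by omega
      rcases hX c (by omega) (hboth e he hde hdf) with h1 | h1
      · omega
      · have := h1 u hu w hw hD
        omega
  · by_cases he3 : c + 3 ≤ e
    · have h1 := (hlate c (Or.inl rfl) e he hde).2 he3
      rcases hX (e - 1) (by omega) h1 with h2 | h2
      · omega
      · have h3 := h2 u' hu' w' hw' hC
        have h4 := ha.le_of_le (show c ≤ e - 1 by omega) (by omega)
        omega
    · have hf3 : c + 3 ≤ f := by
        by_contra hcon
        obtain rfl : e = f := by omega
        rcases hX (c + 1) (by omega) (by rw [hboth e he hde hdf, add_comm]) with h2 | h2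
        · omega
        · have h3 := h2 u' hu' w' hw' hC
          omega
      rcases hD' with ⟨f', hf', hff', hdf'⟩ | ⟨-, hX'⟩
      · exact huniq (c + 1) (c + 1) (by simp) (by simp) f f' hf3 hff' hf' hdf hdf'
      · have h1 := (hlate (c + 1) (Or.inr rfl) f hf hdf).2 hf3
        rcases hX' (f - 1) (by omega) h1 with h2 | h2
        · omega
        · have h3 := h2 u hu w hw hD
          have h4 := ha.le_of_le (show c ≤ f - 1 by omega) (by omega)
          omega

/-- The case of `false_of_one_small` in which a doubling precedes the small step. -/
theorem false_of_doubling_small (h : IsReducedChain n r a) {c t H : ℕ} (hc : 1 ≤ c)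
    (hr : c + t + 3 ≤ r) (hdbl : ∀ s ≤ t + 1, a (c + 1 + s) = 2 ^ s * a (c + 1))
    (hns : ∀ k ≤ c, a (c + 1) ≠ a c + a k)
    (hy : a (c + t + 3) < 2 ^ (t + 2) * H)
    (hlow : ∀ s, c + t + 3 + s ≤ r → 2 ^ (t + 1 + s) * H ≤ a (c + t + 3 + s))
    (hD : 8 * a (c + 1) ≤ 9 * H) (hC : 8 * a c ≤ 7 * H)
    (hCD : 8 * (a c + a (c + 1)) ≤ 15 * H) : False := by
  have ha := h.chain
  set p := c + t + 3 with hp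
  set g := 2 ^ t with hg
  have hg1 : 1 ≤ g := Nat.one_le_two_pow
  have hG : a (p - 1) = 2 * g * a (c + 1) := by
    have := hdbl (t + 1) le_rfl
    rw [show c + 1 + (t + 1) = p - 1 by omega, pow_succ, mul_comm (2 ^ t)] at this
    exact this
  have hG' : a (p - 2) = g * a (c + 1) := by
    have := hdbl t (by omega)
    rwa [show c + 1 + t = p - 2 by omega] at this
  have hClt : a c < a (c + 1) := ha.lt_of_lt (by omega) (by omega)
  have hHpos : 0 < H := by
    have := ha.pos (show c ≤ r by omega)
    omega
  have hgD : 1 * a (c + 1) ≤ g * a (c + 1) := Nat.mul_le_mul_right _ hg1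
  have hgC : 1 * a c ≤ g * a c := Nat.mul_le_mul_right _ hg1
  have hgH : 1 * H ≤ g * H := Nat.mul_le_mul_right _ hg1
  have hD' : g * (8 * a (c + 1)) ≤ g * (9 * H) := Nat.mul_le_mul_left _ hD
  have hC' : g * (8 * a c) ≤ g * (7 * H) := Nat.mul_le_mul_left _ hC
  have hCD' : g * (8 * (a c + a (c + 1))) ≤ g * (15 * H) := Nat.mul_le_mul_left _ hCD
  have hy' : a p < 4 * (g * H) := by
    have : 2 ^ (t + 2) * H = 4 * (g * H) := by rw [pow_add]; ring
    omega
  have hlow' : ∀ s, p + s ≤ r → 2 ^ s * (2 * (g * H)) ≤ a (p + s) := fun s hs => by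
    have h1 := hlow s hs
    have : 2 ^ (t + 1 + s) * H = 2 ^ s * (2 * (g * H)) := by rw [pow_add, pow_add]; ring
    omega
  have hassoc : 2 * g * a (c + 1) = 2 * (g * a (c + 1)) := by ring
  have e1 : g * (8 * a (c + 1)) = 8 * (g * a (c + 1)) := by ring
  have e2 : g * (8 * a c) = 8 * (g * a c) := by ring
  have e3 : g * (9 * H) = 9 * (g * H) := by ring
  have e4 : g * (7 * H) = 7 * (g * H) := by ring
  have e5 : g * (8 * (a c + a (c + 1))) = 8 * (g * a c) + 8 * (g * a (c + 1)) := by ring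
  have e6 : g * (15 * H) = 15 * (g * H) := by ring
  have hlate : ∀ e ≤ r, NeedsTerm a c e → p ≤ e ∧ a e = a c + a (e - 1) := by
    intro e he hd
    obtain ⟨hce, z, hz, hez⟩ := ha.needsTerm_add he hd
    -- Every term from `c + 2` to `p - 1` doubles its predecessor, so it does not need `a c`.
    have hpe : p ≤ e := by
      by_contra hcon
      by_cases h1 : e = c + 1
      · subst h1
        exact hns z (by omega) hez
      · have h2 := hdbl (e - c - 1) (by omega)
        have h3 := hdbl (e - c - 2) (by omega)
        rw [show c + 1 + (e - c - 1) = e by omega, show e - c - 1 = e - c - 2 + 1 by omega,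
          pow_succ] at h2
        rw [show c + 1 + (e - c - 2) = e - 1 by omega] at h3
        have := hd.2 (e - 1) (by omega) (e - 1) (by omega) (by rw [h2, h3]; ring)
        omega
    refine ⟨hpe, ?_⟩
    obtain ⟨s, rfl⟩ := Nat.exists_eq_add_of_le hpe
    rcases s with _ | _ | s
    · have h1 : a (p - 1) < a p := ha.lt_of_lt (by omega) (by omega)
      have h2 : z = p - 1 := by
        by_contra hne
        have h3 := ha.le_of_le (show z ≤ p - 2 by omega) (by omega)
        simp only [add_zero] at hez
        omega
      subst h2
      exact hez
    · have h1 := hlow' 1 he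
      have h2 : z = p := by
        by_contra hne
        have h3 := ha.le_of_le (show z ≤ p - 1 by omega) (by omega)
        simp only [zero_add] at hez
        omega
      subst h2
      exact hez
    · have h2 := ha.eq_pred_of_add (H := 2 * (g * H)) (p := p) (s := s) (hlow' (s + 2) he) he
        (by omega) (by omega) hz hez
      rw [hez, h2]
      rfl
  obtain ⟨e, he, hde, hX⟩ := h.dep c hc (by omega)
  obtain ⟨hpe, hee⟩ := hlate e he hde
  -- Two late additions of `a c` fall short of the growth bound; a single one has a partner beyond
  -- `a c`, against the exchange condition.
  rcases hX with ⟨e', he', hlt, hde'⟩ | ⟨-, hX⟩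
  · obtain ⟨-, hee'⟩ := hlate e' he' hde'
    obtain ⟨s, rfl⟩ := Nat.exists_eq_add_of_le hpe
    rcases s with _ | s
    · obtain ⟨d, rfl⟩ : ∃ d, e' = p + d + 1 := ⟨e' - p - 1, by omega⟩
      have h1 := ha.one_add_le he' hee'
      have h2 := hlow' (d + 1) (by omega)
      have h3 := mul_le_of_two_pow_mul_le (h2.trans h1)
      simp only [add_zero] at hee
      omega
    · obtain ⟨d, rfl⟩ : ∃ d, e' = p + s + 1 + d + 1 := ⟨e' - (p + s + 1) - 1, by omega⟩
      have h1 := ha.two_add_le he' hee hee'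
      have h2 := hlow' (s + d + 2) (by omega)
      rw [show p + (s + d + 2) = p + s + 1 + d + 1 by omega] at h2
      have h3 := mul_le_of_two_pow_mul_le (h2.trans h1)
      omega
  · obtain ⟨u', hu', w', hw', hC0⟩ := ha.2.2.2 c hc (by omega)
    rcases hX (e - 1) (by omega) hee with h2 | h2
    · omega
    · have h3 := h2 u' hu' w' hw' hC0
      have h4 := ha.lt_of_lt (show w' < e - 1 by omega) (by omega)
      omega

/-- The case of `false_of_one_small` in which the small step follows at once. -/
theorem false_of_small (h : IsReducedChain n r a) {c H : ℕ} (hc : 1 ≤ c)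
    (hr : c + 2 ≤ r) (hns : ∀ k ≤ c, a (c + 1) ≠ a c + a k)
    (hy : a (c + 2) < 2 * H)
    (hlow : ∀ s, c + 2 + s ≤ r → 2 ^ s * H ≤ a (c + 2 + s))
    (hD : 8 * a (c + 1) ≤ 9 * H) (hC : 8 * a c ≤ 7 * H)
    (hCD : 8 * (a c + a (c + 1)) ≤ 15 * H)
    (hdec : ∃ u < c, ∃ w < c, a c = a u + a w ∧ ∀ z ≤ w, a (c + 1) < a c + a z →
      ∃ v ≤ c + 1, a c + a z = a (c + 1) + a v) : False := by
  have ha := h.chain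
  obtain ⟨u, hu, w, hw, hDe⟩ := ha.2.2.2 (c + 1) (by omega) (by omega)
  have huc : u < c := by
    by_contra hcon
    obtain rfl : u = c := by omega
    exact hns w (by omega) hDe
  have hwc : w < c := by
    by_contra hcon
    obtain rfl : w = c := by omega
    exact hns u (by omega) (by omega)
  have hlt : a c < a (c + 1) := ha.lt_of_lt (by omega) (by omega)
  have hDy : a (c + 1) < a (c + 2) := ha.lt_of_lt (by omega) (by omega)
  have hwC : a w < a c := ha.lt_of_lt hwc (by omega)
  have hHpos : 0 < H := by
    have := ha.pos (show c ≤ r by omega)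
    omega
  have hCge : ∀ e ≤ r, NeedsTerm a c e → c + 2 ≤ e := by
    intro e he hd
    obtain ⟨hce, z, hz, hez⟩ := ha.needsTerm_add he hd
    by_contra hcon
    obtain rfl : e = c + 1 := by omega
    exact hns z (by omega) hez
  have hClate : ∀ e ≤ r, NeedsTerm a c e → c + 3 ≤ e → a e = a c + a (e - 1) := by
    intro e he hd h3
    obtain ⟨hce, z, hz, hez⟩ := ha.needsTerm_add he hd
    obtain ⟨s, rfl⟩ := Nat.exists_eq_add_of_le h3
    rcases s with _ | s
    · have h1 := hlow 1 he
      have h2 : z = c + 2 := by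
        by_contra hne
        have h3 := ha.le_of_le (show z ≤ c + 1 by omega) (by omega)
        simp only [add_zero] at hez
        have : a (c + 3) = a (c + 2 + 1) := rfl
        omega
      subst h2
      exact hez
    · have h2 := ha.eq_pred_of_add (H := H) (p := c + 2) (s := s) (v := a c) (z := z)
        (by have := hlow (s + 2) (by omega)
            rwa [show c + 2 + (s + 2) = c + 2 + s + 2 by omega] at this)
        (by omega) (by omega) (by omega) (by omega)
        (by rw [← hez]; congr 1; omega)
      rw [hez, h2]
      congr 2
      omega
  have hDlate : (c + 3 ≤ r → a (c + 3) ≠ 2 * a (c + 1)) →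
      ∀ e ≤ r, NeedsTerm a (c + 1) e → c + 3 ≤ e → a e = a (c + 1) + a (e - 1) := by
    intro hn e he hd h3
    obtain ⟨hce, z, hz, hez⟩ := ha.needsTerm_add he hd
    obtain ⟨s, rfl⟩ := Nat.exists_eq_add_of_le h3
    rcases s with _ | s
    · have h1 := hlow 1 he
      have h0 := hn he
      simp only [add_zero] at hez
      have h5 : a (c + 3) = a (c + 2 + 1) := rfl
      have h2 : z = c + 2 := by
        by_contra hne
        by_cases h4 : z = c + 1
        · subst h4
          omega
        · have h3 := ha.le_of_le (show z ≤ c by omega) (by omega)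
          omega
      subst h2
      exact hez
    · have h2 := ha.eq_pred_of_add (H := H) (p := c + 2) (s := s) (v := a (c + 1)) (z := z)
        (by have := hlow (s + 2) (by omega)
            rwa [show c + 2 + (s + 2) = c + 2 + s + 2 by omega] at this)
        (by omega) (by omega) (by omega) (by omega)
        (by rw [← hez]; congr 1; omega)
      rw [hez, h2]
      congr 2
      omega
  -- two late additive steps do not keep up
  have htwo : ∀ v₁ v₂ e e', a (c + 2) + v₁ + v₂ < 4 * H → c + 3 ≤ e → e < e' → e' ≤ r →
      a e = v₁ + a (e - 1) → a e' = v₂ + a (e' - 1) → False := by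
    intro v₁ v₂ e e' hv he hee he' h1 h2
    obtain ⟨s, rfl⟩ : ∃ s, e = c + 2 + s + 1 := ⟨e - (c + 3), by omega⟩
    obtain ⟨d, rfl⟩ : ∃ d, e' = c + 2 + s + 1 + d + 1 := ⟨e' - (c + 2 + s + 1 + 1), by omega⟩
    have h3 := ha.two_add_le he' h1 h2
    have h4 := hlow (s + d + 2) (by omega)
    rw [show c + 2 + (s + d + 2) = c + 2 + s + 1 + d + 1 by omega] at h4
    have h5 := mul_le_of_two_pow_mul_le (h4.trans h3)
    omega
  have hDr : c + 1 < r := by omega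
  obtain ⟨e, he, hde, hX⟩ := h.dep c hc (by omega)
  have he2 := hCge e he hde
  obtain ⟨f, hf, hdf, hX'⟩ := h.dep (c + 1) (by omega) hDr
  have hf2 := (ha.needsTerm_add hf hdf).1
  rcases hX with ⟨e', he', hee', hde'⟩ | ⟨-, hX⟩
  · have he'C := hClate e' he' hde' (by omega)
    have he3 : e = c + 2 := by
      by_contra hne
      exact htwo _ _ e e' (by omega) (by omega) hee' he' (hClate e he hde (by omega)) he'C
    subst he3
    obtain ⟨-, z, hz, hyz⟩ := ha.needsTerm_add he hde
    have hzD := ha.le_of_le (show z ≤ c + 1 by omega) (by omega)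
    -- If `a (c + 3) = 2 * a (c + 1)`, adding `a c` at `e'` leaves the growth factor at most `2 * a
    -- (c + 1) + a c < 4 * H`.
    have hn : c + 3 ≤ r → a (c + 3) ≠ 2 * a (c + 1) := by
      intro hr3 heq
      by_cases h1 : e' = c + 3
      · subst h1
        have := hde'.2 (c + 1) (by omega) (c + 1) (by omega) (by omega)
        omega
      · obtain ⟨s, rfl⟩ : ∃ s, e' = c + 3 + s + 1 := ⟨e' - (c + 4), by omega⟩
        have h2 := ha.one_add_le he' he'C
        have h3 := hlow (s + 2) (by omega)
        rw [show c + 2 + (s + 2) = c + 3 + s + 1 by omega] at h3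
        have h4 := mul_le_of_two_pow_mul_le (h3.trans h2)
        omega
    have hDe2 : ∀ g ≤ r, NeedsTerm a (c + 1) g → g = c + 2 := by
      intro g hg hdg
      have hg2 := (ha.needsTerm_add hg hdg).1
      by_contra hne
      have hgD := hDlate hn g hg hdg (by omega)
      rcases Nat.lt_trichotomy g e' with h1 | h1 | h1
      · exact htwo _ _ g e' (by omega) (by omega) h1 he' hgD he'C
      · subst h1
        omega
      · exact htwo _ _ e' g (by omega) (by omega) h1 hg he'C hgD
    have hf3 := hDe2 f hf hdf
    rcases hX' with ⟨f', hf', hff', hdf'⟩ | ⟨-, hX'⟩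
    · have := hDe2 f' hf' hdf'
      omega
    · subst hf3
      have hzc : z = c + 1 := by
        rcases hdf.2 c (by omega) z hz hyz with h1 | h1 <;> omega
      subst hzc
      rcases hX' c (by omega) (by omega) with h1 | h1
      · omega
      · have := h1 u hu w hw hDe
        omega
  · obtain ⟨u', hu', w', hw', hC0, hz0⟩ := hdec
    have hw'C : a w' < a c := ha.lt_of_lt hw' (by omega)
    by_cases he3 : c + 3 ≤ e
    · rcases hX (e - 1) (by omega) (hClate e he hde he3) with h2 | h2
      · omega
      · have h3 := h2 u' hu' w' hw' hC0
        have h4 := ha.lt_of_lt (show c < e - 1 by omega) (by omega)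
        omega
    · obtain rfl : e = c + 2 := by omega
      obtain ⟨-, z, hz, hyz⟩ := ha.needsTerm_add he hde
      rcases hX z hz hyz with rfl | h2
      · have hfge : ∀ g ≤ r, NeedsTerm a (z + 1) g → z + 3 ≤ g := by
          intro g hg hdg
          have hg2 := (ha.needsTerm_add hg hdg).1
          by_contra hne
          obtain rfl : g = z + 2 := by omega
          have := hdg.2 z (by omega) z (by omega) hyz
          omega
        have hf3 := hfge f hf hdf
        -- Now `a (z + 2) = 2 * a z` also needs a dependent. After `a (z + 3) = 2 * a (z + 1)` that
        -- dependent is too small, as `2 * (a z + a (z + 1)) < 4 * H`.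
        have hn : z + 3 ≤ r → a (z + 3) ≠ 2 * a (z + 1) := by
          intro hr3 heq
          obtain ⟨g, hg, hdg, -⟩ := h.dep (z + 2) (by omega) (by omega)
          obtain ⟨hg2, q, hq, hgq⟩ := ha.needsTerm_add hg hdg
          by_cases h1 : g = z + 3
          · subst h1
            have := hdg.2 (z + 1) (by omega) (z + 1) (by omega) (by omega)
            omega
          · obtain ⟨s, rfl⟩ : ∃ s, g = z + 3 + s + 1 := ⟨g - (z + 4), by omega⟩
            have h2 := ha.add_le (z + 3) s (by omega)
            have h3 := hlow (s + 2) (by omega)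
            rw [show z + 2 + (s + 2) = z + 3 + s + 1 by omega] at h3
            have h4 := ha.le_of_le (show q ≤ z + 3 + s by omega) (by omega)
            have h5 : 1 * (2 * a z) ≤ 2 ^ s * (2 * a z) :=
              Nat.mul_le_mul_right _ Nat.one_le_two_pow
            have h6 : 2 ^ (s + 2) * H ≤ 2 ^ s * (2 * a z + 2 * a (z + 1)) := by
              rw [mul_add, ← heq]
              omega
            have h7 := mul_le_of_two_pow_mul_le h6
            omega
        have hfD := hDlate hn f hf hdf hf3
        rcases hX' with ⟨f', hf', hff', hdf'⟩ | ⟨-, hX'⟩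
        · exact htwo _ _ f f' (by omega) hf3 hff' hf' hfD
            (hDlate hn f' hf' hdf' (by omega))
        · rcases hX' (f - 1) (by omega) hfD with h1 | h1
          · omega
          · have h3 := h1 u hu w hw hDe
            have h4 := ha.lt_of_lt (show z < f - 1 by omega) (by omega)
            omega
      · have h3 := h2 u' hu' w' hw' hC0
        have hzw := ha.le_of_apply_le (by omega) h3
        -- `hdec` rewrites `a (c + 2)` as `a (c + 1) + a v`, so `a c` is needed only if `v = c`; but
        -- then `a z = a (c + 1)`, while `a z ≤ a w'`.
        obtain ⟨v, hv, hve⟩ := hz0 z hzw (by omega)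
        rcases hde.2 (c + 1) (by omega) v (by omega) (by omega) with h4 | rfl
        · omega
        · omega

/-- In a reduced chain, a step not using the preceding term cannot be followed by exactly one
small step, under bounds on its sizes. -/
theorem false_of_one_small (h : IsReducedChain n r a) {c t H : ℕ} (hc : 1 ≤ c)
    (hr : c + 2 + t ≤ r) (hns : ∀ k ≤ c, a (c + 1) ≠ a c + a k)
    (hlow : ∀ s ≤ t, 2 ^ s * H ≤ a (c + 1 + s)) (hy : a (c + 2 + t) < 2 ^ (t + 1) * H)
    (hlow' : ∀ s, c + 2 + t + s ≤ r → 2 ^ (t + s) * H ≤ a (c + 2 + t + s))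
    (hD : 8 * a (c + 1) ≤ 9 * H) (hC : 8 * a c ≤ 7 * H)
    (hCD : 8 * (a c + a (c + 1)) ≤ 15 * H)
    (hdec : ∃ u < c, ∃ w < c, a c = a u + a w ∧ ∀ z ≤ w, a (c + 1) < a c + a z →
      ∃ v ≤ c + 1, a c + a z = a (c + 1) + a v) : False := by
  have ha := h.chain
  have hHpos : 0 < H := by
    have := ha.pos (show c ≤ r by omega)
    omega
  -- Before the small step only doublings keep up: a sum with a summand older than the predecessor
  -- is at most `15/8 * H` at the first step, and `27/8 * 2 ^ s * H` against `4 * 2 ^ s * H` later.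
  have hdbl : ∀ s ≤ t, a (c + 1 + s) = 2 ^ s * a (c + 1) := by
    intro s
    induction s with
    | zero => simp
    | succ s ih =>
      intro hs
      have h1 := ih (by omega)
      have h2 := hlow (s + 1) hs
      obtain ⟨u, hu, w, hw, e⟩ := ha.2.2.2 (c + 1 + (s + 1)) (by omega) (by omega)
      have hprev : a (c + 1 + s) + a (c + s) < 2 ^ (s + 1) * H := by
        rcases s with _ | s
        · simp only [add_zero, zero_add, pow_one]
          omega
        · have h3 := ih
          have h4 := ha.lt_of_lt (show c < c + 1 by omega) (by omega)
          have h5 : a (c + (s + 1)) ≤ 2 ^ s * a (c + 1) := by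
            have := ha.add_le (c + 1) s (by omega)
            rwa [show c + 1 + s = c + (s + 1) by omega] at this
          have h6 : 2 ^ s * (8 * a (c + 1)) ≤ 2 ^ s * (9 * H) := Nat.mul_le_mul_left _ hD
          have h7 : 1 * H ≤ 2 ^ s * H := Nat.mul_le_mul_right _ Nat.one_le_two_pow
          rw [h1]
          have e1 : 2 ^ (s + 1) * a (c + 1) = 2 * (2 ^ s * a (c + 1)) := by rw [pow_succ]; ring
          have e2 : 2 ^ (s + 1 + 1) * H = 4 * (2 ^ s * H) := by rw [pow_succ, pow_succ]; ring
          have e3 : 2 ^ s * (8 * a (c + 1)) = 8 * (2 ^ s * a (c + 1)) := by ring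
          have e4 : 2 ^ s * (9 * H) = 9 * (2 ^ s * H) := by ring
          omega
      have hu1 := ha.le_of_le (show u ≤ c + 1 + s by omega) (by omega)
      have hw1 := ha.le_of_le (show w ≤ c + 1 + s by omega) (by omega)
      have hu2 : u = c + 1 + s := by
        by_contra hne
        have := ha.le_of_le (show u ≤ c + s by omega) (by omega)
        omega
      have hw2 : w = c + 1 + s := by
        by_contra hne
        have := ha.le_of_le (show w ≤ c + s by omega) (by omega)
        omega
      subst hu2
      subst hw2
      rw [e, h1, pow_succ]
      ring
  rcases t with _ | t
  · exact h.false_of_small hc hr hns (by simpa using hy)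
      (fun s hs => by simpa using hlow' s hs) hD hC hCD hdec
  · have e : c + 2 + (t + 1) = c + t + 3 := by omega
    rw [e] at hr hy hlow'
    exact h.false_of_doubling_small hc hr hdbl hns hy hlow' hD hC hCD

end IsReducedChain

/-! ### Powers of two and the count of small steps. -/

theorem two_mul_two_pow_le {x y : ℕ} (h : x < y) : 2 * 2 ^ x ≤ 2 ^ y := by
  rw [← pow_succ']
  exact Nat.pow_le_pow_right (by omega) h

namespace IsAdditionChain

variable {n r : ℕ} {a : ℕ → ℕ}

theorem le_two_pow (h : IsAdditionChain n r a) {i : ℕ} (hi : i ≤ r) : a i ≤ 2 ^ i := by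
  have := h.add_le 0 i (by omega)
  rwa [zero_add, h.1, mul_one] at this

theorem eq_two_pow (h : IsAdditionChain n r a) {i t : ℕ} (hi : i ≤ r) (hp : 2 ^ i ≤ a i)
    (ht : t ≤ i) : a t = 2 ^ t := by
  obtain ⟨d, rfl⟩ := Nat.exists_eq_add_of_le ht
  have h1 := h.add_le t d hi
  have h2 := h.le_two_pow (show t ≤ r by omega)
  have h3 : 2 ^ (d + t) * 1 ≤ 2 ^ d * a t := by
    rw [mul_one, add_comm d]
    exact hp.trans h1
  have h4 := mul_le_of_two_pow_mul_le h3
  omega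

/-- Terms with one small step before them are at most three quarters of the bound `2 ^ (t + 1)`. -/
theorem two_mul_le_of_lt (h : IsAdditionChain n r a) (t : ℕ) (ht : t + 1 ≤ r)
    (hlow : 2 ^ t ≤ a (t + 1)) (hup : a (t + 1) < 2 ^ (t + 1)) :
    2 * a (t + 1) ≤ 3 * 2 ^ t := by
  induction t with
  | zero =>
    have := h.lt_of_lt (show 0 < 1 by omega) ht
    rw [h.1] at this
    simp only [zero_add, pow_one] at hup
    omega
  | succ t ih =>
    have h1 := h.step_le (i := t + 1) ht
    have e1 : 2 ^ (t + 1) = 2 * 2 ^ t := by ring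
    have e2 : 2 ^ (t + 1 + 1) = 4 * 2 ^ t := by ring
    by_cases hlt : a (t + 1) < 2 ^ (t + 1)
    · have := ih (by omega) (by omega) hlt
      omega
    · have hp := fun s (hs : s ≤ t + 1) => h.eq_two_pow (i := t + 1) (by omega) (not_lt.1 hlt) hs
      obtain ⟨u, hu, w, hw, e⟩ := h.2.2.2 (t + 1 + 1) (by omega) ht
      have h2 := h.le_of_le (show u ≤ t + 1 by omega) (by omega)
      have h3 := h.le_of_le (show w ≤ t + 1 by omega) (by omega)
      have h4 := hp (t + 1) le_rfl
      have h5 := hp t (by omega)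
      by_cases hu' : u ≤ t
      · have h6 := h.le_of_le hu' (by omega)
        omega
      · by_cases hw' : w ≤ t
        · have h6 := h.le_of_le hw' (by omega)
          omega
        · obtain rfl : u = t + 1 := by omega
          obtain rfl : w = t + 1 := by omega
          omega

theorem log_le_log_add (h : IsAdditionChain n r a) {i j : ℕ} (hij : i ≤ j) (hj : j ≤ r) :
    Nat.log 2 (a j) ≤ Nat.log 2 (a i) + (j - i) := by
  obtain ⟨d, rfl⟩ := Nat.exists_eq_add_of_le hij
  have h1 := h.add_le i d hj
  have h2 := h.pos (show i ≤ r by omega)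
  have h3 : Nat.log 2 (2 ^ d * a i) = Nat.log 2 (a i) + d := by
    induction d with
    | zero => simp
    | succ d ih =>
      rw [pow_succ, mul_right_comm, Nat.log_mul_base (by omega) (by positivity),
        ih (by omega) (by omega) (h.add_le i d (by omega))]
      omega
  have h4 := Nat.log_mono_right (b := 2) h1
  omega

/-- If the step to `a (c + 1)` is followed by exactly one small step, that step and the size of the
terms around it. -/
theorem exists_small_step (h : IsAdditionChain n r a) {c M : ℕ} (hcr : c + 1 ≤ r)
    (hM : Nat.log 2 (a (c + 1)) = M) (hr : r + M = c + 2 + Nat.log 2 n) :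
    ∃ t, c + 2 + t ≤ r ∧ (∀ s ≤ t, 2 ^ s * 2 ^ M ≤ a (c + 1 + s)) ∧
      a (c + 2 + t) < 2 ^ (t + 1) * 2 ^ M ∧
      ∀ s, c + 2 + t + s ≤ r → 2 ^ (t + s) * 2 ^ M ≤ a (c + 2 + t + s) := by
  classical
  have hmono : M ≤ Nat.log 2 n := by
    rw [← hM, ← h.2.1]
    exact Nat.log_mono_right (h.le_of_le hcr le_rfl)
  have hn : n ≠ 0 := by
    have := h.pos le_rfl
    rw [h.2.1] at this
    omega
  -- The last term has fallen behind: `hr` says that exactly one small step follows index `c + 1`.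
  have hex : ∃ t, a (c + 2 + t) < 2 ^ (t + 1) * 2 ^ M := by
    refine ⟨r - (c + 2), ?_⟩
    rw [show c + 2 + (r - (c + 2)) = r by omega, h.2.1, ← pow_add,
      show r - (c + 2) + 1 + M = Nat.log 2 n + 1 by omega]
    exact Nat.lt_pow_succ_log_self (by omega) n
  have hle : Nat.find hex ≤ r - (c + 2) := Nat.find_min' hex (by
    rw [show c + 2 + (r - (c + 2)) = r by omega, h.2.1, ← pow_add,
      show r - (c + 2) + 1 + M = Nat.log 2 n + 1 by omega]
    exact Nat.lt_pow_succ_log_self (by omega) n)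
  refine ⟨Nat.find hex, by omega, fun s hs => ?_, Nat.find_spec hex, fun s hs => ?_⟩
  · rcases s with _ | s
    · rw [pow_zero, one_mul, add_zero, ← hM]
      exact Nat.pow_log_le_self 2 (by have := h.pos hcr; omega)
    · have h1 := Nat.find_min hex (show s < Nat.find hex by omega)
      rw [show c + 1 + (s + 1) = c + 2 + s by omega]
      exact not_lt.1 h1
  · have h1 := h.log_le_log_add hs le_rfl
    rw [h.2.1] at h1
    have h2 : 2 ^ Nat.log 2 (a (c + 2 + Nat.find hex + s)) ≤ a (c + 2 + Nat.find hex + s) :=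
      Nat.pow_log_le_self 2 (by have := h.pos hs; omega)
    rw [← pow_add]
    exact (Nat.pow_le_pow_right (by omega) (by omega)).trans h2

end IsAdditionChain

/-! ### The three configurations and Hansen's condition. -/

namespace IsReducedChain

variable {n r : ℕ} {a : ℕ → ℕ}

/-- The constants are sharp: `C = (1 + 1/2 + 1/4) * 2 ^ g` with `D = 2 ^ (g + 1)` attains `7/8` and
`15/8`, and `D = 2 ^ (g + 1) + 2 ^ (g - 2)` attains `9/8`. -/
theorem false_of_bounds (h : IsReducedChain n r a) {c M : ℕ} (hc : 1 ≤ c) (hcr : c + 1 ≤ r)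
    (hM : Nat.log 2 (a (c + 1)) = M) (hr : r + M = c + 2 + Nat.log 2 n)
    (hns : ∀ k ≤ c, a (c + 1) ≠ a c + a k)
    (hD : 8 * a (c + 1) ≤ 9 * 2 ^ M) (hC : 8 * a c ≤ 7 * 2 ^ M)
    (hCD : 8 * (a c + a (c + 1)) ≤ 15 * 2 ^ M)
    (hdec : ∃ u < c, ∃ w < c, a c = a u + a w ∧ ∀ z ≤ w, a (c + 1) < a c + a z →
      ∃ v ≤ c + 1, a c + a z = a (c + 1) + a v) : False := by
  obtain ⟨t, ht, h1, h2, h3⟩ := h.chain.exists_small_step hcr hM hr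
  exact h.false_of_one_small hc ht hns h1 h2 h3 hD hC hCD hdec

/-- The configuration `2 ^ g, 2 ^ g + 2 ^ b, 2 ^ g + 2 ^ b + 2 ^ e, 2 ^ (g + 1)`. -/
theorem false_of_power (h : IsReducedChain n r a) {g b e : ℕ} (hcr : g + 3 ≤ r)
    (hr : r = Nat.log 2 n + 3) (hpow : ∀ t ≤ g, a t = 2 ^ t) (hb : b < g) (he : e < g)
    (hbe : e ≠ b) (hB : a (g + 1) = 2 ^ g + 2 ^ b) (hC : a (g + 2) = 2 ^ g + 2 ^ b + 2 ^ e)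
    (hD : a (g + 3) = 2 ^ (g + 1)) (hns : ∀ k ≤ g + 2, a (g + 3) ≠ a (g + 2) + a k) : False := by
  have e1 : 2 ^ (g + 1) = 2 * 2 ^ g := by ring
  have hb1 := two_mul_two_pow_le hb
  have he1 := two_mul_two_pow_le he
  have hbe1 : 2 * 2 ^ b ≤ 2 ^ e ∨ 2 * 2 ^ e ≤ 2 ^ b := by
    rcases Nat.lt_or_gt_of_ne hbe with h1 | h1
    · exact Or.inr (two_mul_two_pow_le h1)
    · exact Or.inl (two_mul_two_pow_le h1)
  have hD' : a (g + 2 + 1) = _ := hD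
  refine h.false_of_bounds (c := g + 2) (M := g + 1) (by omega) hcr (by
    rw [hD]; exact Nat.log_pow (by omega) _) (by omega) hns (by omega) (by omega) (by omega)
    ⟨g + 1, by omega, e, by omega, by rw [hC, hB, hpow e he.le], fun z hz hlt => ?_⟩
  rw [hD', hC, hpow z (by omega)] at hlt
  have hz1 : 2 ^ z ≤ 2 ^ e := Nat.pow_le_pow_right (by omega) hz
  -- `C + 2 ^ z` exceeds `D` only for `z = e = g - 1`, where it equals `D + 2 ^ b`.
  by_cases heg : e + 1 = g
  · have e2 : 2 ^ g = 2 * 2 ^ e := by rw [← heg]; ring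
    by_cases hze : z = e
    · refine ⟨b, by omega, ?_⟩
      rw [hC, hD', hpow z (by omega), hpow b (by omega), hze]
      omega
    · have := two_mul_two_pow_le (show z < e by omega)
      omega
  · have h1 := two_mul_two_pow_le (show e < e + 1 by omega)
    have h2 := two_mul_two_pow_le (show e + 1 < g by omega)
    omega

/-- The configuration `2 ^ g, 2 ^ g + 2 ^ b, 2 ^ g + 2 ^ x, 2 ^ (g + 1) + 2 ^ (b + 1)`. -/
theorem false_of_double (h : IsReducedChain n r a) {g b x : ℕ} (hcr : g + 3 ≤ r)
    (hr : r = Nat.log 2 n + 3) (hpow : ∀ t ≤ g, a t = 2 ^ t) (hbx : b + 1 < x) (hx : x < g)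
    (hC : a (g + 2) = 2 ^ g + 2 ^ x)
    (hD : a (g + 3) = 2 ^ (g + 1) + 2 ^ (b + 1))
    (hns : ∀ k ≤ g + 2, a (g + 3) ≠ a (g + 2) + a k) : False := by
  have e1 : 2 ^ (g + 1) = 2 * 2 ^ g := by ring
  have hb1 := two_mul_two_pow_le hbx
  have hx1 := two_mul_two_pow_le hx
  have hD' : a (g + 2 + 1) = _ := hD
  refine h.false_of_bounds (c := g + 2) (M := g + 1) (by omega) hcr ?_ (by omega) hns (by omega)
    (by omega) (by omega)
    ⟨g, by omega, x, by omega, by rw [hC, hpow x hx.le, hpow g le_rfl], fun z hz hlt => ?_⟩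
  · rw [Nat.log_eq_iff (by omega)]
    have e2 : 2 ^ (g + 1 + 1) = 4 * 2 ^ g := by ring
    have : 0 < 2 ^ b := by positivity
    omega
  · rw [hD', hC, hpow z (by omega)] at hlt
    have hz1 : 2 ^ z ≤ 2 ^ x := Nat.pow_le_pow_right (by omega) hz
    omega

/-- The configuration `1, 2, 3, 6, 8, 12, 16`, times a power of two. -/
theorem false_of_three (h : IsReducedChain n r a) {f : ℕ} (hcr : f + 6 ≤ r)
    (hr : r = Nat.log 2 n + 3) (h1 : a (f + 1) = 2 * 2 ^ f) (h2 : a (f + 2) = 3 * 2 ^ f)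
    (h3 : a (f + 3) = 6 * 2 ^ f) (h5 : a (f + 5) = 12 * 2 ^ f) (h6 : a (f + 6) = 16 * 2 ^ f)
    (hns : ∀ k ≤ f + 5, a (f + 6) ≠ a (f + 5) + a k) : False := by
  have ha := h.chain
  have e1 : 2 ^ (f + 4) = 16 * 2 ^ f := by ring
  have hpos : 0 < 2 ^ f := by positivity
  have h6' : a (f + 5 + 1) = _ := h6
  refine h.false_of_bounds (c := f + 5) (M := f + 4) (by omega) hcr (by
    rw [h6, ← e1]; exact Nat.log_pow (by omega) _) (by omega) hns (by omega) (by omega) (by omega)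
    ⟨f + 3, by omega, f + 3, by omega, by omega, fun z hz hlt => ⟨f + 1, by omega, ?_⟩⟩
  have hz3 : z = f + 3 := by
    by_contra hne
    have := ha.le_of_le (show z ≤ f + 2 by omega) (by omega)
    omega
  subst hz3
  omega

/-- A reduced chain with at most three small steps is a Hansen chain. -/
theorem isHansen (h : IsReducedChain n r a) (hr : r ≤ Nat.log 2 n + 3) : IsHansen r a := by
  have ha := h.chain
  by_contra hcon
  simp only [IsHansen] at hcon
  push Not at hcon
  obtain ⟨i, hi1, hir, hfail⟩ := hcon
  -- Failure of Hansen's condition for `p = i - 1`.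
  have hns : ∀ k < i, a i ≠ a (i - 1) + a k := by
    obtain ⟨t, ht1, ht2, ht3⟩ := hfail (i - 1) (by omega)
    obtain rfl : t = i := by omega
    exact ht3
  have hlog : ∀ j ≤ r, 2 ^ Nat.log 2 (a j) ≤ a j ∧ a j < 2 ^ (Nat.log 2 (a j) + 1) := fun j hj =>
    ⟨Nat.pow_log_le_self 2 (by have := ha.pos hj; omega), Nat.lt_pow_succ_log_self (by omega) _⟩
  have hlogle : ∀ j ≤ r, Nat.log 2 (a j) ≤ j := fun j hj => by
    have := ha.log_le_log_add (Nat.zero_le j) hj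
    simpa [ha.1] using this
  have hi2 : 2 ≤ i := by
    by_contra hlt
    obtain rfl : i = 1 := by omega
    obtain ⟨u, hu, w, hw, e⟩ := ha.2.2.2 1 le_rfl hir
    obtain rfl : u = 0 := by omega
    exact hns w hw e
  -- Some small step comes after index `i`.
  have hsmall : Nat.log 2 n + i < r + Nat.log 2 (a i) := by
    by_contra hlt
    obtain ⟨c, rfl⟩ : ∃ c, i = c + 1 := ⟨i - 1, by omega⟩
    refine h.false_of_forall_large (H := 2 ^ Nat.log 2 (a (c + 1))) (by omega) hir
      (fun k hk => hns k (by omega)) (fun s hs => ?_) ?_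
    · have h1 := ha.log_le_log_add hs le_rfl
      rw [ha.2.1] at h1
      rw [← pow_add]
      exact (Nat.pow_le_pow_right (by omega) (by omega)).trans (hlog _ hs).1
    · have := (hlog _ hir).2
      rwa [pow_succ, mul_comm] at this
  obtain ⟨u, hu, w, hw, hD⟩ := ha.2.2.2 i hi1 hir
  have hu' : u ≠ i - 1 := fun he => hns w hw (by rw [← he]; exact hD)
  have hw' : w ≠ i - 1 := fun he => hns u hu (by rw [← he]; omega)
  have hDup : a i ≤ 2 * a (i - 2) := by
    have h1 := ha.le_of_le (show u ≤ i - 2 by omega) (by omega)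
    have h2 := ha.le_of_le (show w ≤ i - 2 by omega) (by omega)
    omega
  have hlog2 : Nat.log 2 (a i) ≤ Nat.log 2 (a (i - 2)) + 1 := by
    have h1 := Nat.log_mono_right (b := 2) hDup
    rwa [mul_comm, Nat.log_mul_base (by omega)
      (by have := ha.pos (show i - 2 ≤ r by omega); omega)] at h1
  -- beyond a power of two, terms that are sums of earlier powers use that power
  have huse : ∀ g, g ≤ r → a g = 2 ^ g → ∀ t ≤ r, g < t → ∀ u w, u ≤ g → w ≤ g →
      a t = a u + a w → u = g ∨ w = g := by
    intro g hg hp t ht hgt u w hu hw e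
    by_contra hcon
    push Not at hcon
    have h1 := ha.le_of_le (show u ≤ g - 1 by omega) (by omega)
    have h2 := ha.le_of_le (show w ≤ g - 1 by omega) (by omega)
    have h3 := ha.le_two_pow (show g - 1 ≤ r by omega)
    have h4 := ha.lt_of_lt hgt ht
    have h5 : 2 * 2 ^ (g - 1) = 2 ^ g := by
      rw [← pow_succ', show g - 1 + 1 = g by omega]
    omega
  -- Otherwise `a (i - 2) = 2 ^ (i - 2)`, and a failing `t` for `p = i - 2` would be a sum of terms
  -- up to that index, hence would use it.
  have hlev : Nat.log 2 (a (i - 2)) ≠ i - 2 := by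
    intro heq
    have hp : a (i - 2) = 2 ^ (i - 2) := by
      have h1 := (hlog (i - 2) (by omega)).1
      rw [heq] at h1
      exact le_antisymm (ha.le_two_pow (by omega)) h1
    obtain ⟨t, ht1, ht2, ht3⟩ := hfail (i - 2) (by omega)
    obtain ⟨p, hp', q, hq', e⟩ : ∃ p ≤ i - 2, ∃ q ≤ i - 2, a t = a p + a q := by
      by_cases hti : t = i
      · subst hti
        exact ⟨u, by omega, w, by omega, hD⟩
      · obtain ⟨p, hp, q, hq, e⟩ := ha.2.2.2 t (by omega) (by omega)
        exact ⟨p, by omega, q, by omega, e⟩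
    rcases huse (i - 2) (by omega) hp t (by omega) ht1 p q hp' hq' e with rfl | rfl
    · exact ht3 q (by omega) e
    · exact ht3 p (by omega) (by omega)
  have hle2 := hlogle (i - 2) (by omega)
  have hle3 := ha.log_le_log_add (show i - 2 ≤ i by omega) hir
  have hr3 : r = Nat.log 2 n + 3 := by omega
  have hi3 : 3 ≤ i := by
    by_contra hlt
    obtain rfl : i = 2 := by omega
    exact hlev (by simp [ha.1])
  obtain ⟨g, rfl⟩ : ∃ g, i = g + 3 := ⟨i - 3, by omega⟩
  simp only [show g + 3 - 2 = g + 1 by omega, show g + 3 - 1 = g + 2 by omega] at *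
  have hug : u ≤ g + 1 := by omega
  have hwg : w ≤ g + 1 := by omega
  -- Equality in all counts. Below, `A`, `B`, `C`, `D` stand for `a g`, `a (g + 1)`, `a (g + 2)`, `a
  -- (g + 3)`.
  have hlD : Nat.log 2 (a (g + 3)) = g + 1 := by omega
  have hlB : Nat.log 2 (a (g + 1)) = g := by omega
  have hD2 := (hlog (g + 3) hir).1
  rw [hlD] at hD2
  obtain ⟨hB1, hB2⟩ := hlog (g + 1) (by omega)
  rw [hlB] at hB1 hB2
  have hAB : a g < a (g + 1) := ha.lt_of_lt (by omega) (by omega)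
  have hBC : a (g + 1) < a (g + 2) := ha.lt_of_lt (by omega) (by omega)
  have hCD : a (g + 2) < a (g + 3) := ha.lt_of_lt (by omega) hir
  have e1 : 2 ^ (g + 1) = 2 * 2 ^ g := by ring
  obtain ⟨x, hx, y, hy, hCxy⟩ := ha.2.2.2 (g + 2) (by omega) (by omega)
  obtain ⟨b, hb, b', hb', hBb⟩ := ha.2.2.2 (g + 1) (by omega) (by omega)
  -- the second term after a power of two
  have hBform : a g = 2 ^ g → ∃ b < g, a (g + 1) = 2 ^ g + 2 ^ b := by
    intro hp
    have hpow : ∀ t ≤ g, a t = 2 ^ t := fun t ht => ha.eq_two_pow (by omega) hp.ge ht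
    rcases huse g (by omega) hp (g + 1) (by omega) (by omega) b b' (by omega) (by omega) hBb
      with rfl | rfl
    · refine ⟨b', ?_, by rw [hBb, hp, hpow b' (by omega)]⟩
      by_contra hc
      obtain rfl : b' = b := by omega
      omega
    · refine ⟨b, ?_, by rw [hBb, hp, hpow b (by omega)]; ring⟩
      by_contra hc
      obtain rfl : b = b' := by omega
      omega
  by_cases huw : u ≠ g + 1 ∧ w ≠ g + 1
  · obtain ⟨hu1, hw1⟩ := huw
    have h1 := ha.le_of_le (show u ≤ g by omega) (by omega)
    have h2 := ha.le_of_le (show w ≤ g by omega) (by omega)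
    have h3 := ha.le_two_pow (show g ≤ r by omega)
    have hp : a g = 2 ^ g := by omega
    have hpow : ∀ t ≤ g, a t = 2 ^ t := fun t ht => ha.eq_two_pow (by omega) hp.ge ht
    obtain ⟨b, hbg, hBf⟩ := hBform hp
    -- `B = A + 2 ^ b` and `D = 2 * A` use `A`, so `p = g` can fail only at `C`.
    have hCg : ∀ k < g + 2, a (g + 2) ≠ a g + a k := by
      obtain ⟨t, ht1, ht2, ht3⟩ := hfail g (by omega)
      rcases (show t = g + 1 ∨ t = g + 2 ∨ t = g + 3 by omega) with rfl | rfl | rfl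
      · exact absurd (by rw [hBf, hp, hpow b hbg.le]) (ht3 b (by omega))
      · exact ht3
      · exact absurd (by omega) (ht3 g (by omega))
    have hform : ∃ e < g, a (g + 2) = a (g + 1) + a e := by
      have hxg : x ≠ g := fun he => hCg y hy (by rw [hCxy, he])
      have hyg : y ≠ g := fun he => hCg x hx (by rw [hCxy, he, add_comm])
      by_cases hx1 : x = g + 1
      · by_cases hy1 : y = g + 1
        · subst hx1
          subst hy1
          omega
        · exact ⟨y, by omega, by rw [hCxy, hx1]⟩
      · by_cases hy1 : y = g + 1
        · exact ⟨x, by omega, by rw [hCxy, hy1, add_comm]⟩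
        · rcases huse g (by omega) hp (g + 2) (by omega) (by omega) x y (by omega) (by omega) hCxy
            with h4 | h4
          · exact absurd h4 hxg
          · exact absurd h4 hyg
    obtain ⟨e, he, hCe⟩ := hform
    refine h.false_of_power hir hr3 hpow hbg he ?_ hBf (by rw [hCe, hBf, hpow e he.le]) (by omega)
      (fun k hk => hns k (by omega))
    rintro rfl
    refine hCg (e + 1) (by omega) ?_
    rw [hCe, hBf, hp, hpow e he.le, hpow (e + 1) (by omega)]
    ring
  obtain ⟨k, hk, hDk⟩ : ∃ k ≤ g + 1, a (g + 3) = a (g + 1) + a k := by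
    rcases not_and_or.1 huw with h1 | h1
    · exact ⟨w, hwg, by rw [hD, not_ne_iff.1 h1]⟩
    · exact ⟨u, hug, by rw [hD, not_ne_iff.1 h1, add_comm]⟩
  -- `D` uses `B`, so `p = g + 1` fails at `C`.
  have hCB : ∀ k < g + 2, a (g + 2) ≠ a (g + 1) + a k := by
    obtain ⟨t, ht1, ht2, ht3⟩ := hfail (g + 1) (by omega)
    rcases (show t = g + 2 ∨ t = g + 3 by omega) with rfl | rfl
    · exact ht3
    · exact absurd hDk (ht3 k (by omega))
  have hxB : x ≠ g + 1 := fun he => hCB y hy (by rw [hCxy, he])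
  have hyB : y ≠ g + 1 := fun he => hCB x hx (by rw [hCxy, he, add_comm])
  by_cases hp : 2 ^ g ≤ a g
  · have hpow : ∀ t ≤ g, a t = 2 ^ t := fun t ht => ha.eq_two_pow (by omega) hp ht
    have hpg := hpow g le_rfl
    obtain ⟨b, hbg, hBf⟩ := hBform hpg
    obtain ⟨x, hx, hCx⟩ : ∃ x ≤ g, a (g + 2) = a g + a x := by
      rcases huse g (by omega) hpg (g + 2) (by omega) (by omega) x y (by omega) (by omega) hCxy
        with rfl | rfl
      · exact ⟨y, by omega, hCxy⟩
      · exact ⟨x, by omega, by omega⟩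
    -- If `D = B + A`, then `B`, `C` and `D` all use `A`, and `p = g` would do.
    have hkg : k ≠ g := by
      rintro rfl
      obtain ⟨t, ht1, ht2, ht3⟩ := hfail k (by omega)
      rcases (show t = k + 1 ∨ t = k + 2 ∨ t = k + 3 by omega) with rfl | rfl | rfl
      · exact ht3 b (by omega) (by rw [hBf, hpg, hpow b hbg.le])
      · exact ht3 x (by omega) hCx
      · exact ht3 (k + 1) (by omega) (by omega)
    have hb1 := two_mul_two_pow_le hbg
    have hkk : k = g + 1 := by
      by_contra hne
      have h1 := hpow k (by omega)
      have h2 := two_mul_two_pow_le (show k < g by omega)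
      have h3 := hpow x hx
      rcases hx.eq_or_lt with rfl | hxg
      · omega
      · have hbx : b < x := by
          by_contra hc
          have : 2 ^ x ≤ 2 ^ b := Nat.pow_le_pow_right (by omega) (by omega)
          omega
        have h4 := two_mul_two_pow_le hbx
        have h5 := two_mul_two_pow_le hxg
        have : 0 < 2 ^ b := by positivity
        omega
    subst hkk
    have e2 : 2 ^ (b + 1) = 2 * 2 ^ b := by ring
    rcases hx.eq_or_lt with rfl | hxg
    · refine hns (b + 1) (by omega) ?_
      rw [hpow (b + 1) (by omega)]
      omega
    · have hx1 := hpow x hx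
      have hbx : b < x := by
        by_contra hc
        have : 2 ^ x ≤ 2 ^ b := Nat.pow_le_pow_right (by omega) (by omega)
        omega
      refine h.false_of_double (b := b) hir hr3 hpow ?_ hxg (by omega) (by omega)
        (fun k hk => hns k (by omega))
      by_contra hc
      obtain rfl : x = b + 1 := by omega
      exact hns g (by omega) (by omega)
  · -- the term `a g` already comes after a small step
    have hg1 : 1 ≤ g := by
      by_contra hc
      obtain rfl : g = 0 := by omega
      exact hp (by simp [ha.1])
    obtain ⟨q, rfl⟩ : ∃ q, g = q + 1 := ⟨g - 1, by omega⟩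
    have hA2 : 2 ^ q ≤ a (q + 1) := by
      have h1 := ha.step_le (i := q + 1) (by omega)
      have : 2 ^ (q + 1) = 2 * 2 ^ q := by ring
      omega
    have e2 : 2 ^ (q + 1) = 2 * 2 ^ q := by ring
    have hq1 := ha.le_two_pow (show q ≤ r by omega)
    -- `C = A + a x`
    obtain ⟨x, hx, hCx⟩ : ∃ x ≤ q + 1, a (q + 1 + 2) = a (q + 1) + a x := by
      by_cases hx1 : x = q + 1
      · exact ⟨y, by omega, by rw [hCxy, hx1]⟩
      · by_cases hy1 : y = q + 1
        · exact ⟨x, by omega, by rw [hCxy, hy1, add_comm]⟩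
        · have h1 := ha.le_of_le (show x ≤ q by omega) (by omega)
          have h2 := ha.le_of_le (show y ≤ q by omega) (by omega)
          omega
    have hxA := ha.le_of_le hx (by omega)
    by_cases hq : 2 ^ q ≤ a q
    · have hpow : ∀ t ≤ q, a t = 2 ^ t := fun t ht => ha.eq_two_pow (by omega) hq ht
      have hpq := hpow q le_rfl
      obtain ⟨d, hd, hAd⟩ : ∃ d < q, a (q + 1) = 2 ^ q + 2 ^ d := by
        obtain ⟨v, hv, v', hv', e⟩ := ha.2.2.2 (q + 1) (by omega) (by omega)
        rcases huse q (by omega) hpq (q + 1) (by omega) (by omega) v v' (by omega) (by omega) e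
          with rfl | rfl
        · refine ⟨v', ?_, by rw [e, hpq, hpow v' (by omega)]⟩
          by_contra hc
          obtain rfl : v' = v := by omega
          omega
        · refine ⟨v, ?_, by rw [e, hpq, hpow v (by omega)]; ring⟩
          by_contra hc
          obtain rfl : v = v' := by omega
          omega
      have hd1 := two_mul_two_pow_le hd
      have hdpos : 0 < 2 ^ d := by positivity
      have e3 : 2 ^ (d + 1) = 2 * 2 ^ d := by ring
      have had := hpow d hd.le
      have had1 := hpow (d + 1) (by omega)
      -- `B = 2 * A` is impossible since `B < C ≤ 2 * A`. In the remaining cases each candidate for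
      -- `C` is at most `B` or is `B` plus `2 ^ d` or `2 ^ (d + 1)`, against `hCB`.
      have hBcase : a (q + 1 + 1) = 2 * 2 ^ q ∨ a (q + 1 + 1) = 2 * 2 ^ q + 2 ^ d := by
        have key : ∀ v ≤ q + 1, a (q + 1 + 1) = a (q + 1) + a v →
            a (q + 1 + 1) = 2 * 2 ^ q ∨ a (q + 1 + 1) = 2 * 2 ^ q + 2 ^ d := by
          intro v hv e
          rcases (show v = q + 1 ∨ v = q ∨ v < q by omega) with rfl | rfl | hvq
          · omega
          · omega
          · have h1 := hpow v hvq.le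
            have h2 := two_mul_two_pow_le hvq
            omega
        by_cases hb1 : b = q + 1
        · exact key b' (by omega) (by rw [hBb, hb1])
        · by_cases hb1' : b' = q + 1
          · exact key b (by omega) (by rw [hBb, hb1', add_comm])
          · have h1 := ha.le_of_le (show b ≤ q by omega) (by omega)
            have h2 := ha.le_of_le (show b' ≤ q by omega) (by omega)
            omega
      have hn1 := hCB d (by omega)
      have hn2 := hCB (d + 1) (by omega)
      rcases (show x = q + 1 ∨ x = q ∨ x < q by omega) with rfl | rfl | hxq
      · omega
      · omega
      · have h1 := hpow x hxq.le
        have h2 := two_mul_two_pow_le hxq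
        omega
    · have hq0 : 1 ≤ q := by
        by_contra hc
        obtain rfl : q = 0 := by omega
        exact hq (by simp [ha.1])
      obtain ⟨j, rfl⟩ : ∃ j, q = j + 1 := ⟨q - 1, by omega⟩
      have e3 : 2 ^ (j + 1) = 2 * 2 ^ j := by ring
      have hmA := ha.two_mul_le_of_lt (j + 1) (by omega) hA2 (not_le.1 hp)
      have hstep := ha.step_le (i := j + 1) (by omega)
      have hmE := ha.two_mul_le_of_lt j (by omega) (by omega) (not_le.1 hq)
      have hj := ha.le_two_pow (show j ≤ r by omega)
      obtain ⟨v, hv, hBv⟩ : ∃ v ≤ j + 1, a (j + 1 + 1 + 1) = a (j + 1 + 1) + a v := by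
        have key : ∀ v ≤ j + 1 + 1, a (j + 1 + 1 + 1) = a (j + 1 + 1) + a v →
            ∃ v ≤ j + 1, a (j + 1 + 1 + 1) = a (j + 1 + 1) + a v := by
          intro v hv e
          refine ⟨v, ?_, e⟩
          by_contra hc
          obtain rfl : v = j + 1 + 1 := by omega
          omega
        by_cases hb1 : b = j + 1 + 1
        · exact key b' (by omega) (by rw [hBb, hb1])
        · by_cases hb1' : b' = j + 1 + 1
          · exact key b (by omega) (by rw [hBb, hb1', add_comm])
          · have h1 := ha.le_of_le (show b ≤ j + 1 by omega) (by omega)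
            have h2 := ha.le_of_le (show b' ≤ j + 1 by omega) (by omega)
            omega
      have hvx : v < x := ha.lt_of_apply_lt (by omega) (by omega)
      rcases hv.eq_or_lt with rfl | hvj
      · -- here `C = 2 * A`
        obtain rfl : x = j + 1 + 1 := by omega
        obtain ⟨z, hz, z', hz', hA⟩ := ha.2.2.2 (j + 1 + 1) (by omega) (by omega)
        by_cases hz1 : z = j + 1
        · subst hz1
          exact hCB z' (by omega) (by omega)
        · by_cases hz1' : z' = j + 1
          · subst hz1'
            exact hCB z (by omega) (by omega)
          · have h1 := ha.le_of_le (show z ≤ j by omega) (by omega)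
            have h2 := ha.le_of_le (show z' ≤ j by omega) (by omega)
            omega
      · have hvj' := ha.le_of_le (show v ≤ j by omega) (by omega)
        -- The bound `A ≤ 3 * 2 ^ j` and `B ≥ 4 * 2 ^ j` force equality: in units of `2 ^ f` the
        -- terms up to `B` end in `1, 2, 3, 6, 8`. Then `C` is `12`, the third configuration, or `9
        -- = 8 + 1`, which uses `B`.
        have hpj : a j = 2 ^ j := by omega
        have hpow : ∀ t ≤ j, a t = 2 ^ t := fun t ht => ha.eq_two_pow (by omega) hpj.ge ht
        have hj0 : 1 ≤ j := by
          by_contra hc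
          obtain rfl : j = 0 := by omega
          simp only [pow_zero] at *
          omega
        obtain ⟨f, rfl⟩ : ∃ f, j = f + 1 := ⟨j - 1, by omega⟩
        have e4 : 2 ^ (f + 1) = 2 * 2 ^ f := by ring
        have hf := hpow f (by omega)
        rcases hx.eq_or_lt with rfl | hxlt
        · have hk1 : k = f + 1 + 1 + 1 + 1 := by
            by_contra hne
            have h1 := ha.le_of_le (show k ≤ f + 1 + 1 + 1 by omega) (by omega)
            omega
          subst hk1
          exact h.false_of_three (f := f) hir hr3 (by omega)
            (by have : a (f + 2) = a (f + 1 + 1) := rfl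
                omega)
            (by have : a (f + 3) = a (f + 1 + 1 + 1) := rfl
                omega)
            (by have : a (f + 5) = a (f + 1 + 1 + 1 + 2) := rfl
                omega)
            (by have : a (f + 6) = a (f + 1 + 1 + 1 + 3) := rfl
                omega)
            (fun k hk => hns k (by omega))
        · have hx1 : x = f + 1 + 1 := by
            have : v = f + 1 := ha.eq_of_apply_eq (by omega) (by omega) (by omega)
            omega
          subst hx1
          exact hCB f (by omega) (by omega)

end IsReducedChain

/-! ### Star chains. -/

/-- There is a chain of length `r` for `N`, containing all elements of `K`, in which each step uses
the preceding term. -/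
def HasStarChain (r N : ℕ) (K : Set ℕ) : Prop :=
  ∃ a, IsAdditionChain N r a ∧ (∀ i < r, ∃ j ≤ i, a (i + 1) = a i + a j) ∧ ∀ x ∈ K, ∃ j ≤ r, a j = x

namespace HasStarChain

variable {r N : ℕ} {K : Set ℕ}

theorem one : HasStarChain 0 1 {1} :=
  ⟨fun _ => 1, ⟨rfl, rfl, by omega, by omega⟩, by omega, fun x hx => ⟨0, le_rfl, hx.symm⟩⟩

theorem add (h : HasStarChain r N K) {x M : ℕ} (hx : x = N ∨ x ∈ K) (hM : M = N + x) :
    HasStarChain (r + 1) M (insert N K) := by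
  subst hM
  obtain ⟨a, ha, hstar, hK⟩ := h
  obtain ⟨j, hj, rfl⟩ : ∃ j ≤ r, a j = x := by
    rcases hx with rfl | hx
    · exact ⟨r, le_rfl, ha.2.1⟩
    · exact hK x hx
  have hnew : Function.update a (r + 1) (N + a j) (r + 1) = N + a j := Function.update_self ..
  have hold : ∀ i ≤ r, Function.update a (r + 1) (N + a j) i = a i := fun i hi =>
    Function.update_of_ne (by omega) ..
  have hN := ha.2.1
  refine ⟨Function.update a (r + 1) (N + a j), ⟨?_, hnew, fun i hi => ?_, fun i hi1 hi => ?_⟩,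
    fun i hi => ?_, fun x hx => ?_⟩
  · rw [hold 0 (by omega), ha.1]
  · rcases (show i < r ∨ i = r by omega) with hi' | rfl
    · rw [hold i hi'.le, hold (i + 1) hi']
      exact ha.2.2.1 i hi'
    · rw [hold i le_rfl, hnew, hN]
      have := ha.pos hj
      omega
  · rcases (show i ≤ r ∨ i = r + 1 by omega) with hi' | rfl
    · obtain ⟨u, hu, w, hw, e⟩ := ha.2.2.2 i hi1 hi'
      refine ⟨u, hu, w, hw, ?_⟩
      rw [hold i hi', hold u (by omega), hold w (by omega), e]
    · refine ⟨r, by omega, j, by omega, ?_⟩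
      rw [hnew, hold r le_rfl, hold j hj, hN]
  · rcases (show i < r ∨ i = r by omega) with hi' | rfl
    · obtain ⟨u, hu, e⟩ := hstar i hi'
      refine ⟨u, hu, ?_⟩
      rw [hold i hi'.le, hold (i + 1) hi', hold u (by omega), e]
    · refine ⟨j, hj, ?_⟩
      rw [hnew, hold i le_rfl, hold j hj, hN]
  · rcases hx with rfl | hx
    · exact ⟨r, by omega, by rw [hold r le_rfl, hN]⟩
    · obtain ⟨i, hi, rfl⟩ := hK x hx
      exact ⟨i, by omega, hold i hi⟩

theorem mono (h : HasStarChain r N K) {K' : Set ℕ} (hK : K' ⊆ K) : HasStarChain r N K' := by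
  obtain ⟨a, ha, hstar, hm⟩ := h
  exact ⟨a, ha, hstar, fun x hx => hm x (hK hx)⟩

theorem mul_two_pow (h : HasStarChain r N K) (d : ℕ) : HasStarChain (r + d) (N * 2 ^ d) K := by
  induction d with
  | zero => simpa using h
  | succ d ih =>
    exact (ih.add (Or.inl rfl) (by ring)).mono (Set.subset_insert _ _)

/-- A star chain satisfies Hansen's condition with `p = i - 1`. -/
theorem chainLength_mersenne_le (h : HasStarChain r N K) :
    chainLength (2 ^ N - 1) ≤ r + N - 1 := by
  obtain ⟨a, ha, hstar, -⟩ := h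
  refine ha.chainLength_mersenne_le fun i hi hir => ⟨i - 1, by omega, fun t ht hti => ?_⟩
  obtain rfl : t = i := by omega
  obtain ⟨j, hj, e⟩ := hstar (t - 1) (by omega)
  exact ⟨j, by omega, by rwa [show t - 1 + 1 = t by omega] at e⟩

end HasStarChain

/-! ### The Scholz inequality for `n`. -/

/-- The Scholz inequality for numbers having a chain with at most three small steps. -/
theorem chainLength_mersenne_le_of_chainLength_le {n : ℕ} (hn : 0 < n)
    (h : chainLength n ≤ Nat.log 2 n + 3) :
    chainLength (2 ^ n - 1) ≤ chainLength n + n - 1 := by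
  obtain ⟨a, ha⟩ := exists_isReducedChain n hn
  exact ha.chain.chainLength_mersenne_le (ha.isHansen h)

theorem thurberNumber_eq (m k : ℕ) :
    thurberNumber m k =
      (5 * 2 ^ (m + 2) + 3) * 2 ^ (m + k + 3) + (3 * 2 ^ (m + 1) + 1) := by
  have hrep : ∀ j, Nat.ofDigits 2 (List.replicate j 0) = 0 := fun j => by
    induction j with
    | zero => rfl
    | succ j ih => rw [List.replicate_succ, Nat.ofDigits_cons, ih]
  simp only [thurberNumber, thurberDigits, List.reverse_append, List.reverse_replicate,
    Nat.ofDigits_append, List.reverse_cons, List.reverse_nil, List.nil_append, hrep,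
    List.length_append, List.length_replicate, List.length_cons, List.length_nil,
    Nat.ofDigits_cons, Nat.ofDigits_nil]
  ring

theorem binaryWeight_thurberNumber (m k : ℕ) : binaryWeight (thurberNumber m k) = 7 := by
  rw [binaryWeight, thurberNumber, Nat.digits_ofDigits 2 (by omega)]
  · simp [thurberDigits, List.count_append, List.count_replicate]
  · intro l hl
    simp only [thurberDigits, List.mem_reverse, List.mem_append, List.mem_replicate,
      List.mem_cons, List.not_mem_nil, or_false] at hl
    omega
  · intro h
    simp [thurberDigits]

theorem log_thurberNumber {m k : ℕ} (hm : 1 ≤ m) (hk : 3 ≤ k) :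
    Nat.log 2 (thurberNumber m k) = 2 * m + k + 7 := by
  rw [Nat.log_eq_iff (by omega), thurberNumber_eq]
  have hX : 2 ^ 1 ≤ 2 ^ m := Nat.pow_le_pow_right (by omega) hm
  have hY : 2 ^ 3 ≤ 2 ^ k := Nat.pow_le_pow_right (by omega) hk
  have e1 : 2 ^ (2 * m + k + 7) = 128 * (2 ^ m * 2 ^ m * 2 ^ k) := by ring
  have e2 : 2 ^ (2 * m + k + 7 + 1) = 256 * (2 ^ m * 2 ^ m * 2 ^ k) := by ring
  have e3 : (5 * 2 ^ (m + 2) + 3) * 2 ^ (m + k + 3) + (3 * 2 ^ (m + 1) + 1) =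
      160 * (2 ^ m * 2 ^ m * 2 ^ k) + 24 * (2 ^ m * 2 ^ k) + 6 * 2 ^ m + 1 := by ring
  rw [e1, e2, e3]
  have h1 : 2 * (2 ^ m * 2 ^ k) ≤ 2 ^ m * 2 ^ m * 2 ^ k := by
    rw [mul_assoc]
    exact Nat.mul_le_mul_right _ hX
  have h2 : 2 ^ m * 8 ≤ 2 ^ m * 2 ^ k := Nat.mul_le_mul_left _ hY
  omega

/-- With `c₁`, `c₂` as in `mainTheorem1`, the chain climbs to `2 ^ (m + 2)`, then runs `2 ^ (m + 2)
+ 1`, `c₂`, `2 ^ (m + 3) + 1`, `2 * c₂`, `c₁`, doubles `c₁` `m + k + 3` times and adds `c₂`. -/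
theorem hasStarChain_thurberNumber (m k : ℕ) :
    HasStarChain (2 * m + k + 11) (thurberNumber m k) ∅ := by
  have h0 : HasStarChain (m + 1) (2 ^ (m + 1)) {1} := by
    have := HasStarChain.one.mul_two_pow (m + 1)
    rwa [zero_add, one_mul] at this
  have h1 := h0.add (M := 2 ^ (m + 2)) (Or.inl rfl) (by ring)
  have h2 := h1.add (x := 1) (M := 2 ^ (m + 2) + 1) (by simp) rfl
  have h3 := h2.add (x := 2 ^ (m + 1)) (M := 3 * 2 ^ (m + 1) + 1) (by simp) (by ring)
  have h4 := h3.add (x := 2 ^ (m + 1)) (M := 2 ^ (m + 3) + 1) (by simp) (by ring)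
  have h5 := h4.add (x := 2 ^ (m + 2) + 1) (M := 6 * 2 ^ (m + 1) + 2) (by simp) (by ring)
  have h6 := h5.add (x := 2 ^ (m + 3) + 1) (M := 5 * 2 ^ (m + 2) + 3) (by simp) (by ring)
  have h7 := (h6.mul_two_pow (m + k + 3)).add (x := 3 * 2 ^ (m + 1) + 1) (by simp)
    (thurberNumber_eq m k)
  rw [show m + 1 + 1 + 1 + 1 + 1 + 1 + 1 + (m + k + 3) + 1 = 2 * m + k + 11 by ring] at h7
  exact h7.mono (Set.empty_subset _)

theorem mainTheorem1 (m k : ℕ) (hm : 1 ≤ m) (hk : 3 ≤ k) (c₁ c₂ n : ℕ)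
    (hc₁ : c₁ = 5 * 2 ^ (m + 2) + 3) (hc₂ : c₂ = 3 * 2 ^ (m + 1) + 1)
    (hn : n = thurberNumber m k) :
    n = c₁ * 2 ^ (m + k + 3) + c₂ ∧ binaryWeight n = 7 ∧
      chainLength (2 ^ n - 1) ≤ chainLength n + n - 1 := by
  subst hc₁ hc₂ hn
  refine ⟨thurberNumber_eq m k, binaryWeight_thurberNumber m k, ?_⟩
  have hlog := log_thurberNumber hm hk
  by_cases h : chainLength (thurberNumber m k) ≤ Nat.log 2 (thurberNumber m k) + 3
  · refine chainLength_mersenne_le_of_chainLength_le ?_ h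
    rw [thurberNumber_eq]
    omega
  -- Here `chainLength n` is at least `2 * m + k + 11`, the length of the star chain.
  · have := (hasStarChain_thurberNumber m k).chainLength_mersenne_le
    omega
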